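/- **Setting.** Let $V,W$ be sets, and let $A$ (over $V\times V$) and $B$ (over $W\times W$) be matrices with entries in $\mathbb N$ that are essential (no zero rows, no zero columns) and have finitely summing rows. Let $m\ge 1$, let $R$ (over $V\times W$) and $S$ (over $W\times V$) be matrices with entries in $\mathbb N$, and put, over $V\sqcup W$, $$C=\begin{bmatrix}A&0\\0&B\end{bmatrix},\qquad D=\begin{bmatrix}0&R\\S&0\end{bmatrix}.$$ A matrix $F$ with entries in $\mathbb N$ has the edge set $E_F=\{(v,w,k): 0\le k<F_{vw}\}$ with $s(v,w,k)=v$, $r(v,w,k)=w$; a square $F$ gives a directed graph $G_F$. Write $E_F\times E_{F'}=\{ef: r(e)=s(f)\}$, and $E_F^n$ for the paths of length $n$ in $G_F$ ($E_F^0$ being the vertices). A path isomorphism is a bijection that preserves sources and ranges. A Cuntz–Krieger family for $G_F$ consists of pairwise orthogonal projections $P_v$ and operators $S_e$ with $S_e^*S_e=P_{r(e)}$ and $\sum_{s(e)=v}S_eS_e^*=P_v$ whenever $0<|s^{-1}(v)|<\infty$; $C^*(G_F)$ is the universal C*-algebra generated by such a family, and $S_\lambda=S_{e_1}\cdots S_{e_n}$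 for a path $\lambda=e_1\cdots e_n$ (with $S_v=P_v$ for a vertex $v$). **Hypothesis.** There are given path isomorphisms $\phi:E_C\times E_D\to E_D\times E_C$ and $\psi:E_D^2\to E_C^m$, and $A$ and $B$ are representable shift equivalent with lag $m$ via $R,S,\phi,\psi$: there are Cuntz–Krieger families $(P_v,S_c)$ for $G_C$ and $(P_v,T_d)$ for $G_D$ on one Hilbert space, with the same projections $P_v$ and with $P_v\neq0$ for all $v\in V\sqcup W$, such that $T_{d_1}T_{d_2}=S_{c_1}\cdots S_{c_m}$ whenever $\psi(d_1d_2)=c_1\cdots c_m$, and $S_cT_d=T_{d'}S_{c'}$ whenever $\phi(cd)=d'c'$. **Notation.** Let now $(P_v,S_c)$ and $(P_v,T_d)$ denote the universal families in $C^*(G_C)$ and $C^*(G_D)$ respectively. For $\mathcal A_\infty^C$ and $X(A)_\infty$ take the closed linear spans in $C^*(G_C)$ of the elements $S_\lambda S_{\lambda'}^*$ with $r(\lambda)=r(\lambda')$, $s(\lambda),s(\lambda')\in V$ and $|\lambda|=|\lambda'|$, respectively $|\lambda|=|\lambda'|+1$; for $\mathcal B_\infty^C$ and $X(B)_\infty$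 do the same with $W$ in place of $V$. Define $\mathcal A_\infty^D,\mathcal B_\infty^D\subseteq C^*(G_D)$ as $\mathcal A^C_\infty,\mathcal B^C_\infty$, with $T_\mu T_{\mu'}^*$ in place of $S_\lambda S_{\lambda'}^*$, and let $X(R)_\infty\subseteq C^*(G_D)$ be the closed linear span of the $T_\mu T_{\mu'}^*$ with $r(\mu)=r(\mu')$, $|\mu|=|\mu'|+1$, $s(\mu)\in V$, $s(\mu')\in W$. With multiplication as actions and $\langle x,y\rangle=x^*y$, the spaces $X(A)_\infty$, $X(B)_\infty$ and $X(R)_\infty$ are C*-correspondences over $\mathcal A_\infty^C$, over $\mathcal B_\infty^C$, and from $\mathcal B_\infty^D$ (on the right) to $\mathcal A_\infty^D$ (on the left). **Proposition.** Under the hypothesis, $X(A)_\infty$ and $X(B)_\infty$ are strong Morita shift equivalent with lag $m$ via $R$, $S$ and $\psi$. That is: there are $*$-isomorphisms $\Psi^A:\mathcal A_\infty^D\to\mathcal A_\infty^C$ and $\Psi^B:\mathcal B_\infty^D\to\mathcal B_\infty^C$ determined by $$T_{\mu_1\cdots\mu_k}T_{\mu_1'\cdots\mu_k'}^*\longmapsto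 S_{\psi(\mu_1)\cdots\psi(\mu_k)}S_{\psi(\mu'_1)\cdots\psi(\mu'_k)}^*\qquad(\mu_i,\mu_i'\in E_D^2,\ k\ge0),$$ and, when its coefficient algebras are identified with $\mathcal A_\infty^C$ and $\mathcal B_\infty^C$ through $\Psi^A$ and $\Psi^B$, $X(R)_\infty$ is a strong Morita equivalence between $X(A)_\infty$ and $X(B)_\infty$: it is an imprimitivity $\mathcal A_\infty^C$-$\mathcal B_\infty^C$ bimodule (it is full, and the left action is a $*$-isomorphism onto the compact operators $\mathcal K(X(R)_\infty)$), and there is an isometric linear surjection $$U:X(A)_\infty\otimes_{\mathcal A_\infty^C}X(R)_\infty\longrightarrow X(R)_\infty\otimes_{\mathcal B_\infty^C}X(B)_\infty$$ with $U(a\xi b)=aU(\xi)b$ for all $\xi$, $a\in\mathcal A_\infty^C$ and $b\in\mathcal B_\infty^C$. -/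

import Mathlib

open scoped ENNReal

universe u v x

noncomputable section

/-! ### Directed graphs, paths and path isomorphisms -/

/-- A directed graph with vertex set `Ω`, given by its sets of edges `E v w` from `v` to `w`
(that is, with source `v` and range `w`). -/
abbrev ArrowGraph (Ω : Type u) := Ω → Ω → Type x

/-- `GPath E n v w` is the set of paths `e₁ ⋯ eₙ` of length `n` with source `v` and range `w`
(`s (e_{i+1}) = r (e_i)`); paths of length `0` are the vertices. -/
inductive GPath {Ω : Type u} (E : ArrowGraph.{u, x} Ω) : ℕ → Ω → Ω → Type (max u x)
  | nil (v : Ω) : GPath E 0 v v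
  | cons {v w z : Ω} {n : ℕ} (e : E v w) (p : GPath E n w z) : GPath E (n + 1) v z

/-- The fibred product `E × F = { ef | r(e) = s(f) }`, as a set of arrows `v → w`. -/
def GProd {Ω : Type u} (E F : ArrowGraph.{u, x} Ω) : ArrowGraph.{u, max u x} Ω :=
  fun v w => Σ z : Ω, E v z × F z w

/-- A path isomorphism: a bijection that preserves sources and ranges, i.e. a family of bijections
between the sets of arrows with given source and given range. -/
def PathIso {Ω : Type u} (E F : ArrowGraph.{u, x} Ω) := ∀ v w : Ω, E v w ≃ F v w

/-- Every vertex emits finitely many edges. -/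
def RowFinite {Ω : Type u} (E : ArrowGraph.{u, x} Ω) : Prop :=
  ∀ v, Finite (Σ w : Ω, E v w)

/-- The edges of a matrix `F` with entries in `ℕ`: the triples `(v, w, k)` with `0 ≤ k < F v w`,
with source `v` and range `w`. -/
def Matrix.graph {Ω : Type u} (F : Matrix Ω Ω ℕ) : ArrowGraph.{u, 0} Ω := fun v w => Fin (F v w)

/-- No zero rows and no zero columns. -/
def Matrix.Essential {V : Type u} (A : Matrix V V ℕ) : Prop :=
  (∀ v, ∃ w, A v w ≠ 0) ∧ (∀ w, ∃ v, A v w ≠ 0)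

/-- Every row has a finite sum, i.e. (the entries being natural numbers) finitely many non-zero
entries. -/
def Matrix.FinitelySummingRows {V : Type u} (A : Matrix V V ℕ) : Prop :=
  ∀ v, {w | A v w ≠ 0}.Finite

/-- The matrix `C = [A 0; 0 B]`, as a graph on `V ⊔ W`. -/
abbrev graphC {V W : Type u} (A : Matrix V V ℕ) (B : Matrix W W ℕ) : ArrowGraph.{u, 0} (V ⊕ W) :=
  (Matrix.fromBlocks A 0 0 B).graph

/-- The matrix `D = [0 R; S 0]`, as a graph on `V ⊔ W`. -/
abbrev graphD {V W : Type u} (R : Matrix V W ℕ) (S : Matrix W V ℕ) : ArrowGraph.{u, 0} (V ⊕ W) :=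
  (Matrix.fromBlocks 0 R S 0).graph

/-- The vertices in `V`. -/
abbrev partV (V W : Type u) : Set (V ⊕ W) := Set.range Sum.inl

/-- The vertices in `W`. -/
abbrev partW (V W : Type u) : Set (V ⊕ W) := Set.range Sum.inr

/-! ### Cuntz-Krieger families -/

/-- `(P_v, S_e)` is a Cuntz-Krieger family for the graph `E` in the `*`-algebra `𝔄`. -/
structure IsCKFamily {Ω : Type u} (E : ArrowGraph.{u, x} Ω) {𝔄 : Type v} [NonUnitalRing 𝔄] [StarRing 𝔄]
    (P : Ω → 𝔄) (S : ∀ ⦃v w : Ω⦄, E v w → 𝔄) : Prop where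
  isStarProjection : ∀ v, IsStarProjection (P v)
  orthogonal : ∀ v w, v ≠ w → P v * P w = 0
  star_mul_self : ∀ {v w : Ω} (e : E v w), star (S e) * S e = P w
  sum_eq : ∀ v, Finite (Σ w : Ω, E v w) → Nonempty (Σ w : Ω, E v w) →
    ∑ᶠ e : (Σ w : Ω, E v w), S e.2 * star (S e.2) = P v

/-- The element `S_λ = S_{e₁} ⋯ S_{eₙ}` of a path `λ = e₁ ⋯ eₙ`, with `S_v = P_v` for a path of
length `0`. (In a Cuntz-Krieger family the factor `P_{r(λ)}` that this definition leaves at the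
right end changes nothing when `n > 0`, since `S_e = S_e P_{r(e)}`.) -/
def pathOp {Ω : Type u} {E : ArrowGraph.{u, x} Ω} {𝔄 : Type v} [Mul 𝔄]
    (P : Ω → 𝔄) (S : ∀ ⦃v w : Ω⦄, E v w → 𝔄) : ∀ {n : ℕ} {v w : Ω}, GPath E n v w → 𝔄
  | _, _, _, GPath.nil v => P v
  | _, _, _, GPath.cons e p => S e * pathOp P S p

/-- `R` and `S` are representable via the path isomorphisms `φ : E_C × E_D → E_D × E_C` and
`ψ : E_D² → E_C^m`. -/
def Representable {V W : Type u} (A : Matrix V V ℕ) (B : Matrix W W ℕ) (m : ℕ)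
    (R : Matrix V W ℕ) (S : Matrix W V ℕ)
    (φ : PathIso (GProd (graphC A B) (graphD R S)) (GProd (graphD R S) (graphC A B)))
    (ψ : PathIso (GPath (graphD R S) 2) (GPath (graphC A B) m)) : Prop :=
  ∃ (H : Type u) (_ : NormedAddCommGroup H) (_ : InnerProductSpace ℂ H) (_ : CompleteSpace H)
    (P : V ⊕ W → H →L[ℂ] H)
    (SC : ∀ ⦃v w : V ⊕ W⦄, graphC A B v w → H →L[ℂ] H)
    (TD : ∀ ⦃v w : V ⊕ W⦄, graphD R S v w → H →L[ℂ] H),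
    IsCKFamily (graphC A B) P SC ∧ IsCKFamily (graphD R S) P TD ∧ (∀ v, P v ≠ 0) ∧
    (∀ (v w : V ⊕ W) (μ : GPath (graphD R S) 2 v w), pathOp P TD μ = pathOp P SC (ψ v w μ)) ∧
    (∀ (v w : V ⊕ W) (cd : GProd (graphC A B) (graphD R S) v w),
      SC cd.2.1 * TD cd.2.2 = TD (φ v w cd).2.1 * SC (φ v w cd).2.2)

/-! ### The graph C*-algebra

It is built as the C*-algebra generated by the direct sum of all Cuntz-Krieger families on Hilbert
spaces (in the universe of the vertex set, which contains Hilbert spaces of every dimension that a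
cyclic representation can have). -/

/-- A Cuntz-Krieger family for `E` on a Hilbert space. -/
structure HilbertCKFamily {Ω : Type u} (E : ArrowGraph.{u, 0} Ω) : Type (u + 1) where
  H : Type u
  [normedAddCommGroup : NormedAddCommGroup H]
  [innerProductSpace : InnerProductSpace ℂ H]
  [completeSpace : CompleteSpace H]
  P : Ω → H →L[ℂ] H
  S : ∀ ⦃v w : Ω⦄, E v w → H →L[ℂ] H
  isCKFamily : IsCKFamily E P S

attribute [instance] HilbertCKFamily.normedAddCommGroup HilbertCKFamily.innerProductSpace
  HilbertCKFamily.completeSpace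

/-- Bounded families of operators, indexed by the Cuntz-Krieger families for `E`. -/
abbrev BoundedOps {Ω : Type u} (E : ArrowGraph.{u, 0} Ω) : Type (u + 1) :=
  lp (fun i : HilbertCKFamily E => i.H →L[ℂ] i.H) ∞

section CKFacts

variable {Ω : Type u} {E : ArrowGraph.{u, x} Ω} {𝔄 : Type v} [NonUnitalCStarAlgebra 𝔄]
  {P : Ω → 𝔄} {S : ∀ ⦃v w : Ω⦄, E v w → 𝔄}

theorem IsCKFamily.norm_P_le (h : IsCKFamily E P S) (v : Ω) : ‖P v‖ ≤ 1 :=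
  (h.isStarProjection v).norm_le

theorem IsCKFamily.norm_S_le (h : IsCKFamily E P S) {v w : Ω} (e : E v w) : ‖S e‖ ≤ 1 := by
  have h1 : ‖S e‖ * ‖S e‖ ≤ 1 := by
    rw [← CStarRing.norm_star_mul_self, h.star_mul_self]
    exact h.norm_P_le w
  nlinarith [norm_nonneg (S e)]

theorem IsCKFamily.S_mul_P (h : IsCKFamily E P S) {v w : Ω} (e : E v w) : S e * P w = S e := by
  have hP := h.isStarProjection w
  have hs : star (P w) = P w := hP.isSelfAdjoint
  have hi : P w * P w = P w := hP.isIdempotentElem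
  rw [← sub_eq_zero, ← CStarRing.star_mul_self_eq_zero_iff]
  have e1 : P w * star (S e) * (S e * P w) = P w := by
    rw [mul_assoc, ← mul_assoc (star (S e)), h.star_mul_self, hi, hi]
  have e2 : P w * star (S e) * S e = P w := by rw [mul_assoc, h.star_mul_self, hi]
  have e3 : star (S e) * (S e * P w) = P w := by rw [← mul_assoc, h.star_mul_self, hi]
  rw [star_sub, star_mul, hs, mul_sub, sub_mul, sub_mul, e1, e2, e3, h.star_mul_self]
  simp

/-- The range projections of the edges that leave a vertex with finitely many edges are mutually
orthogonal. -/
theorem IsCKFamily.star_mul_of_ne (h : IsCKFamily E P S) (hE : RowFinite E) (v : Ω)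
    (e f : Σ w : Ω, E v w) (hef : e ≠ f) : star (S e.2) * S f.2 = 0 := by
  classical
  let _ := CStarAlgebra.spectralOrder 𝔄
  have _ := CStarAlgebra.spectralOrderedRing 𝔄
  have := hE v
  let _ := Fintype.ofFinite (Σ w : Ω, E v w)
  set q : (Σ w : Ω, E v w) → 𝔄 := fun g => S g.2 * star (S g.2) with hq
  have hsum : ∑ g, q g = P v := by
    rw [← h.sum_eq v (hE v) ⟨e⟩, finsum_eq_sum_of_fintype]
  have hqs : ∀ g, star (q g) = q g := fun g => by simp [hq]
  have hSP : ∀ g : (Σ w : Ω, E v w), star (S g.2) * S g.2 = P g.1 := fun g => h.star_mul_self g.2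
  have hqi : ∀ g, q g * q g = q g := fun g => by
    simp only [hq]
    rw [mul_assoc, ← mul_assoc (star _) (S g.2), hSP, ← mul_assoc, h.S_mul_P]
  have hp := h.isStarProjection v
  have hps : star (P v) = P v := hp.isSelfAdjoint
  have hpi : P v * P v = P v := hp.isIdempotentElem
  have hterm : ∀ g, star (q g * q f) * (q g * q f) = q f * q g * q f := fun g => by
    
    rw [star_mul (q g) (q f), hqs, hqs, mul_assoc (q f) (q g), ← mul_assoc (q g) (q g), hqi,
      mul_assoc (q f) (q g)]
  have htot : ∑ g, star (q g * q f) * (q g * q f) = q f * P v * q f := by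
    simp only [hterm]
    rw [← Finset.sum_mul, ← Finset.mul_sum, hsum]
  have hle : q f * P v * q f ≤ q f := by
    rw [← sub_nonneg]
    have : q f - q f * P v * q f = star (q f - P v * q f) * (q f - P v * q f) := by
      rw [star_sub, star_mul (P v) (q f), hqs, hps, mul_sub, sub_mul, sub_mul, hqi]
      have : q f * P v * (P v * q f) = q f * P v * q f := by
        rw [mul_assoc (q f) (P v), ← mul_assoc (P v) (P v), hpi, mul_assoc (q f) (P v)]
      rw [this, ← mul_assoc (q f) (P v)]
      abel
    rw [this]
    exact star_mul_self_nonneg _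
  have hsplit : ∑ g, star (q g * q f) * (q g * q f)
      = star (q f * q f) * (q f * q f) +
        ∑ g ∈ Finset.univ.erase f, star (q g * q f) * (q g * q f) :=
    (Finset.add_sum_erase _ _ (Finset.mem_univ f)).symm
  have hff : star (q f * q f) * (q f * q f) = q f := by rw [hqi, hqs, hqi]
  have hle0 : ∑ g ∈ Finset.univ.erase f, star (q g * q f) * (q g * q f) ≤ 0 := by
    have := htot ▸ hle
    rw [← htot, hsplit, hff] at hle
    simpa using hle
  have hnn : ∀ g ∈ Finset.univ.erase f, 0 ≤ star (q g * q f) * (q g * q f) :=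
    fun g _ => star_mul_self_nonneg _
  have hz := (Finset.sum_eq_zero_iff_of_nonneg hnn).1
    (le_antisymm hle0 (Finset.sum_nonneg hnn)) e (Finset.mem_erase.2 ⟨hef, Finset.mem_univ _⟩)
  have hz' : q e * q f = 0 := (CStarRing.star_mul_self_eq_zero_iff _).1 hz
  have key : star (S e.2) * S f.2 = star (S e.2) * (q e * q f) * S f.2 := by
    simp only [hq]
    calc star (S e.2) * S f.2 = star (S e.2 * P e.1) * (S f.2 * P f.1) := by
          rw [h.S_mul_P, h.S_mul_P]
      _ = (P e.1 * star (S e.2)) * (S f.2 * P f.1) := by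
          rw [star_mul, (h.isStarProjection e.1).isSelfAdjoint]
      _ = _ := by rw [← hSP e, ← hSP f]; simp only [mul_assoc]
  rw [key, hz']
  simp

theorem IsCKFamily.P_mul_S (h : IsCKFamily E P S) (hE : RowFinite E) {v w : Ω} (e : E v w) :
    P v * S e = S e := by
  classical
  have := hE v
  let _ := Fintype.ofFinite (Σ w : Ω, E v w)
  rw [← h.sum_eq v (hE v) ⟨⟨w, e⟩⟩, finsum_eq_sum_of_fintype, Finset.sum_mul,
    Finset.sum_eq_single (⟨w, e⟩ : Σ w : Ω, E v w)]
  · rw [mul_assoc, h.star_mul_self, h.S_mul_P]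
  · intro g _ hg
    rw [mul_assoc, h.star_mul_of_ne hE v g ⟨w, e⟩ hg, mul_zero]
  · simp

theorem IsCKFamily.P_mul_pathOp (h : IsCKFamily E P S) (hE : RowFinite E) {n : ℕ} {v w : Ω}
    (p : GPath E n v w) : P v * pathOp P S p = pathOp P S p := by
  cases p with
  | nil => exact (h.isStarProjection v).isIdempotentElem
  | cons e p => simp only [pathOp]; rw [← mul_assoc, h.P_mul_S hE]

theorem IsCKFamily.P_mul_pathOp_of_ne (h : IsCKFamily E P S) (hE : RowFinite E) {n : ℕ}
    {v w z : Ω} (hz : z ≠ v) (p : GPath E n v w) : P z * pathOp P S p = 0 := by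
  rw [← h.P_mul_pathOp hE p, ← mul_assoc, h.orthogonal z v hz, zero_mul]

/-- Concatenation of paths. -/
def GPath.comp {Ω : Type u} {E : ArrowGraph.{u, x} Ω} : ∀ {n k : ℕ} {v w z : Ω},
    GPath E n v w → GPath E k w z → Σ' l : ℕ, Σ' _ : l = n + k, GPath E l v z
  | _, k, _, _, _, GPath.nil _, q => ⟨k, by omega, q⟩
  | _, _, _, _, _, GPath.cons e p, q =>
    ⟨(p.comp q).1 + 1, by have := (p.comp q).2.1; omega, GPath.cons e (p.comp q).2.2⟩

theorem IsCKFamily.pathOp_mul_pathOp (h : IsCKFamily E P S) (hE : RowFinite E) {n k : ℕ}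
    {v w z : Ω} (p : GPath E n v w) (q : GPath E k w z) :
    pathOp P S p * pathOp P S q = pathOp P S (p.comp q).2.2 := by
  induction p with
  | nil => exact h.P_mul_pathOp hE q
  | cons e p ih => simp only [pathOp, GPath.comp]; rw [mul_assoc, ih]

/-- `S_μ^* S_ν` is `0` or `S_ν'` with `ν = μ ν'`, when `μ` is not longer than `ν`. -/
theorem IsCKFamily.star_pathOp_mul (h : IsCKFamily E P S) (hE : RowFinite E) {n k : ℕ}
    {v w v' w' : Ω} (p : GPath E n v w) (q : GPath E k v' w') (hnk : n ≤ k) :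
    star (pathOp P S p) * pathOp P S q = 0 ∨
      ∃ (l : ℕ) (r : GPath E l w w'), l + n = k ∧
        star (pathOp P S p) * pathOp P S q = pathOp P S r := by
  induction p generalizing k v' w' with
  | nil v =>
    have hs : star (pathOp (E := E) P S (GPath.nil v)) = P v :=
      (h.isStarProjection v).isSelfAdjoint
    rw [hs]
    by_cases hv : v = v'
    · subst hv
      exact Or.inr ⟨k, q, rfl, h.P_mul_pathOp hE q⟩
    · exact Or.inl (h.P_mul_pathOp_of_ne hE hv q)
  | @cons v w z n e p ih =>
    cases q with
    | nil => omega
    | @cons _ w₂ _ k f q =>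
      have hrw : star (pathOp (E := E) P S (GPath.cons e p)) * pathOp (E := E) P S (GPath.cons f q)
          = star (pathOp P S p) * ((star (S e) * S f) * pathOp P S q) := by
        simp only [pathOp, star_mul, mul_assoc]
      rw [hrw]
      by_cases hv : v = v'
      · subst hv
        by_cases hef : (⟨w, e⟩ : Σ w : Ω, E v w) = ⟨w₂, f⟩
        · cases hef
          rw [h.star_mul_self, h.P_mul_pathOp hE]
          rcases ih q (by omega) with h0 | ⟨l, r, hl, hr⟩
          · exact Or.inl h0
          · exact Or.inr ⟨l, r, by omega, hr⟩
        · left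
          rw [h.star_mul_of_ne hE v _ _ hef]
          simp
      · left
        have : star (S e) * S f = 0 := by
          rw [← h.P_mul_S hE e, ← h.P_mul_S hE f, star_mul,
            (h.isStarProjection v).isSelfAdjoint, mul_assoc, ← mul_assoc (P v) (P v'),
            h.orthogonal v v' hv]
          simp
        rw [this]
        simp

end CKFacts

namespace GraphCStar

variable {Ω : Type u} (E : ArrowGraph.{u, 0} Ω)

/-- The direct sum of the projections `P_v` of all Cuntz-Krieger families. -/
def univP (v : Ω) : BoundedOps E :=
  ⟨fun i => i.P v, memℓp_infty ⟨1, by rintro _ ⟨i, rfl⟩; exact i.isCKFamily.norm_P_le v⟩⟩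

/-- The direct sum of the partial isometries `S_e` of all Cuntz-Krieger families. -/
def univS ⦃v w : Ω⦄ (e : E v w) : BoundedOps E :=
  ⟨fun i => i.S e, memℓp_infty ⟨1, by rintro _ ⟨i, rfl⟩; exact i.isCKFamily.norm_S_le e⟩⟩

/-- The closed `*`-algebra generated by all `P_v` and `S_e`. -/
def subalgebra : NonUnitalStarSubalgebra ℂ (BoundedOps E) :=
  (NonUnitalStarAlgebra.adjoin ℂ
    (Set.range (univP E) ∪ {a | ∃ (v w : Ω) (e : E v w), a = univS E e})).topologicalClosure

instance isClosed_subalgebra : IsClosed (subalgebra E : Set (BoundedOps E)) :=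
  NonUnitalStarSubalgebra.isClosed_topologicalClosure _

end GraphCStar

/-- The graph C*-algebra `C*(E)`. -/
def GraphCStar {Ω : Type u} (E : ArrowGraph.{u, 0} Ω) : Type (u + 1) := ↥(GraphCStar.subalgebra E)

namespace GraphCStar

variable {Ω : Type u} (E : ArrowGraph.{u, 0} Ω)

instance : NonUnitalCStarAlgebra (GraphCStar E) :=
  NonUnitalStarSubalgebra.nonUnitalCStarAlgebra (subalgebra E)

/-- The universal projections `P_v ∈ C*(E)`. -/
def P (v : Ω) : GraphCStar E :=
  ⟨univP E v, NonUnitalStarSubalgebra.le_topologicalClosure _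
    (NonUnitalStarAlgebra.subset_adjoin ℂ _ (Or.inl ⟨v, rfl⟩))⟩

/-- The universal partial isometries `S_e ∈ C*(E)`. -/
def S ⦃v w : Ω⦄ (e : E v w) : GraphCStar E :=
  ⟨univS E e, NonUnitalStarSubalgebra.le_topologicalClosure _
    (NonUnitalStarAlgebra.subset_adjoin ℂ _ (Or.inr ⟨v, w, e, rfl⟩))⟩

/-- The universal property: every Cuntz-Krieger family on a Hilbert space is the image of the
universal one under a `*`-homomorphism of `C*(E)`. -/
def rep (i : HilbertCKFamily E) : GraphCStar E →⋆ₙₐ[ℂ] (i.H →L[ℂ] i.H) where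
  toFun a := a.1 i
  map_smul' _ _ := rfl
  map_zero' := rfl
  map_add' _ _ := rfl
  map_mul' _ _ := rfl
  map_star' _ := rfl

theorem rep_P (i : HilbertCKFamily E) (v : Ω) : rep E i (P E v) = i.P v := rfl

theorem rep_S (i : HilbertCKFamily E) {v w : Ω} (e : E v w) : rep E i (S E e) = i.S e := rfl

variable {E} in
theorem ext_rep {a b : GraphCStar E} (h : ∀ i, rep E i a = rep E i b) : a = b :=
  Subtype.ext (lp.ext (funext h))

theorem isCKFamily : IsCKFamily E (P E) (S E) where
  isStarProjection v :=
    ⟨ext_rep fun i => (map_mul (rep E i) _ _).trans (i.isCKFamily.isStarProjection v).1,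
      ext_rep fun i => (map_star (rep E i) _).trans (i.isCKFamily.isStarProjection v).2⟩
  orthogonal v w hvw := ext_rep fun i => by
    rw [map_mul, map_zero]; exact i.isCKFamily.orthogonal v w hvw
  star_mul_self e := ext_rep fun i => by
    rw [map_mul, map_star]; exact i.isCKFamily.star_mul_self e
  sum_eq v hf hn := ext_rep fun i => by
    let _ := Fintype.ofFinite (Σ w : Ω, E v w)
    have := i.isCKFamily.sum_eq v hf hn
    rw [finsum_eq_sum_of_fintype] at this ⊢
    rw [map_sum, rep_P, ← this]
    rfl

/-- The closed linear span of the elements `S_μ S_ν^*` where `μ` and `ν` are paths with the same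
range, `|μ| - |ν| = d`, `s(μ) ∈ K` and `s(ν) ∈ L`. -/
def spectral (d : ℤ) (K L : Set Ω) : Submodule ℂ (GraphCStar E) :=
  (Submodule.span ℂ {a | ∃ (n k : ℕ) (v v' w : Ω) (μ : GPath E n v w) (ν : GPath E k v' w),
    (n : ℤ) = k + d ∧ v ∈ K ∧ v' ∈ L ∧
      a = pathOp (P E) (S E) μ * star (pathOp (P E) (S E) ν)}).topologicalClosure


section Spectral

variable {E}

theorem pathOp_mul_mem_spectral {d : ℤ} {K L : Set Ω} {n k : ℕ} {v v' w : Ω} (μ : GPath E n v w)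
    (ν : GPath E k v' w) (hd : (n : ℤ) = k + d) (hv : v ∈ K) (hv' : v' ∈ L) :
    pathOp (P E) (S E) μ * star (pathOp (P E) (S E) ν) ∈ spectral E d K L :=
  Submodule.le_topologicalClosure _ (Submodule.subset_span ⟨n, k, v, v', w, μ, ν, hd, hv, hv', rfl⟩)

theorem spectral_star_mem {d : ℤ} {K L : Set Ω} {a : GraphCStar E} (ha : a ∈ spectral E d K L) :
    star a ∈ spectral E (-d) L K := by
  have hcl : IsClosed {a : GraphCStar E | star a ∈ spectral E (-d) L K} :=
    (Submodule.isClosed_topologicalClosure _).preimage continuous_star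
  refine closure_minimal (fun a ha => ?_) hcl ha
  induction ha using Submodule.span_induction with
  | mem a h =>
    obtain ⟨n, k, v, v', w, μ, ν, hd, hv, hv', rfl⟩ := h
    simp only [Set.mem_ofPred_eq, star_mul, star_star]
    exact pathOp_mul_mem_spectral ν μ (by omega) hv' hv
  | zero => simp
  | add x y _ _ hx hy => simpa using add_mem hx hy
  | smul c x _ hx => simpa using Submodule.smul_mem _ _ hx

theorem gen_mul_gen_mem (hE : RowFinite E) {d d' : ℤ} {K M : Set Ω} {n k n' k' : ℕ}
    {v v' w u u' z : Ω} (μ : GPath E n v w) (ν : GPath E k v' w) (hd : (n : ℤ) = k + d)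
    (hv : v ∈ K) (μ' : GPath E n' u z) (ν' : GPath E k' u' z)
    (hd' : (n' : ℤ) = k' + d') (hu' : u' ∈ M) :
    pathOp (P E) (S E) μ * star (pathOp (P E) (S E) ν) *
      (pathOp (P E) (S E) μ' * star (pathOp (P E) (S E) ν')) ∈ spectral E (d + d') K M := by
  have h := isCKFamily E
  rcases le_total k n' with hkn | hkn
  · have : pathOp (P E) (S E) μ * star (pathOp (P E) (S E) ν) *
        (pathOp (P E) (S E) μ' * star (pathOp (P E) (S E) ν'))
        = pathOp (P E) (S E) μ * (star (pathOp (P E) (S E) ν) * pathOp (P E) (S E) μ') *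
          star (pathOp (P E) (S E) ν') := by simp only [mul_assoc]
    rw [this]
    rcases h.star_pathOp_mul hE ν μ' hkn with h0 | ⟨l, r, hl, hr⟩
    · rw [h0]; simp
    · rw [hr, h.pathOp_mul_pathOp hE]
      have := (μ.comp r).2.1
      exact pathOp_mul_mem_spectral _ _ (by omega) hv hu'
  · have : pathOp (P E) (S E) μ * star (pathOp (P E) (S E) ν) *
        (pathOp (P E) (S E) μ' * star (pathOp (P E) (S E) ν'))
        = pathOp (P E) (S E) μ * star (pathOp (P E) (S E) ν' *
          (star (pathOp (P E) (S E) μ') * pathOp (P E) (S E) ν)) := by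
      simp only [mul_assoc, star_mul, star_star]
    rw [this]
    rcases h.star_pathOp_mul hE μ' ν hkn with h0 | ⟨l, r, hl, hr⟩
    · rw [h0]; simp
    · rw [hr, h.pathOp_mul_pathOp hE]
      have := (ν'.comp r).2.1
      exact pathOp_mul_mem_spectral _ _ (by omega) hv hu'

theorem spectral_mul_mem (hE : RowFinite E) {d d' : ℤ} {K L M : Set Ω} {a b : GraphCStar E}
    (ha : a ∈ spectral E d K L) (hb : b ∈ spectral E d' L M) :
    a * b ∈ spectral E (d + d') K M := by
  have hC : IsClosed (spectral E (d + d') K M : Set (GraphCStar E)) :=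
    Submodule.isClosed_topologicalClosure _
  have hcl : ∀ b, IsClosed {a : GraphCStar E | a * b ∈ spectral E (d + d') K M} := fun b =>
    hC.preimage (continuous_id.mul continuous_const)
  have hcl' : ∀ a, IsClosed {b : GraphCStar E | a * b ∈ spectral E (d + d') K M} := fun a =>
    hC.preimage (continuous_const.mul continuous_id)
  refine closure_minimal (fun a ha => ?_) (hcl b) ha
  refine closure_minimal (fun b hb => ?_) (hcl' a) hb
  simp only [Set.mem_ofPred_eq]
  induction ha using Submodule.span_induction with
  | mem a h =>
    obtain ⟨n, k, v, v', w, μ, ν, hd, hv, hv', rfl⟩ := h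
    induction hb using Submodule.span_induction with
    | mem b h =>
      obtain ⟨n', k', u, u', z, μ', ν', hd', hu, hu', rfl⟩ := h
      exact gen_mul_gen_mem hE μ ν hd hv μ' ν' hd' hu'
    | zero => simp
    | add x y _ _ hx hy => rw [mul_add]; exact add_mem hx hy
    | smul c x _ hx => rw [mul_smul_comm]; exact Submodule.smul_mem _ _ hx
  | zero => simp
  | add x y _ _ hx hy => rw [add_mul]; exact add_mem hx hy
  | smul c x _ hx => rw [smul_mul_assoc]; exact Submodule.smul_mem _ _ hx

end Spectral

/-- The C*-algebra that is the closed span of the elements `S_μ S_ν^*` with `|μ| = |ν|`,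
`r(μ) = r(ν)` and sources in `K`. -/
def core (hE : RowFinite E) (K : Set Ω) : NonUnitalStarSubalgebra ℂ (GraphCStar E) where
  carrier := spectral E 0 K K
  add_mem' ha hb := add_mem ha hb
  zero_mem' := zero_mem _
  smul_mem' c _ ha := Submodule.smul_mem _ c ha
  mul_mem' ha hb := by simpa using spectral_mul_mem hE ha hb
  star_mem' ha := by simpa using spectral_star_mem ha

instance isClosed_core (hE : RowFinite E) (K : Set Ω) :
    IsClosed (core E hE K : Set (GraphCStar E)) :=
  Submodule.isClosed_topologicalClosure _

end GraphCStar

/-! ### C*-correspondences -/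

/-- An `A`-`B` C*-correspondence: a right Hilbert `B`-module with a non-degenerate
`*`-representation of `A` by adjointable operators. (An operator `lsmul a` is adjointable with
adjoint `lsmul (star a)`.) -/
structure CStarCorrespondence (A B : Type v) [NonUnitalCStarAlgebra A] [NonUnitalCStarAlgebra B] :
    Type (v + 1) where
  carrier : Type v
  [normedAddCommGroup : NormedAddCommGroup carrier]
  [normedSpace : NormedSpace ℂ carrier]
  [completeSpace : CompleteSpace carrier]
  /-- the `B`-valued inner product, linear in the second variable -/
  inner : carrier → carrier →ₗ[ℂ] B
  /-- the right action, `rsmul b x = x b` -/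
  rsmul : B →ₗ[ℂ] carrier →ₗ[ℂ] carrier
  /-- the left action, `lsmul a x = a x` -/
  lsmul : A →ₗ[ℂ] carrier →L[ℂ] carrier
  star_inner : ∀ x y, star (inner x y) = inner y x
  inner_self_nonneg : ∀ x, ∃ b, inner x x = star b * b
  norm_sq : ∀ x, ‖x‖ ^ 2 = ‖inner x x‖
  inner_rsmul : ∀ x y b, inner x (rsmul b y) = inner x y * b
  rsmul_mul : ∀ b c x, rsmul (b * c) x = rsmul c (rsmul b x)
  lsmul_mul : ∀ a c x, lsmul (a * c) x = lsmul a (lsmul c x)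
  inner_lsmul : ∀ a x y, inner (lsmul a x) y = inner x (lsmul (star a) y)
  nondegenerate :
    (Submodule.span ℂ {y : carrier | ∃ a x, y = lsmul a x}).topologicalClosure = ⊤

attribute [instance] CStarCorrespondence.normedAddCommGroup CStarCorrespondence.normedSpace
  CStarCorrespondence.completeSpace

namespace CStarCorrespondence

section

variable {A B C : Type v} [NonUnitalCStarAlgebra A] [NonUnitalCStarAlgebra B]
  [NonUnitalCStarAlgebra C]

/-- `K(X)`: the closed linear span of the rank one operators `ζ ↦ ξ ⟨η, ζ⟩`. -/
def compacts (X : CStarCorrespondence A B) : Submodule ℂ (X.carrier →L[ℂ] X.carrier) :=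
  (Submodule.span ℂ {T : X.carrier →L[ℂ] X.carrier |
    ∃ ξ η : X.carrier, ∀ ζ, T ζ = X.rsmul (X.inner η ζ) ξ}).topologicalClosure

/-- `⟨X, X⟩` is all of `B`. -/
def IsFull (X : CStarCorrespondence A B) : Prop :=
  (Submodule.span ℂ {b : B | ∃ x y, b = X.inner x y}).topologicalClosure = ⊤

/-- Imprimitivity bimodules: full, and the left action is a `*`-isomorphism onto `K(X)`. -/
def IsImprimitivity (X : CStarCorrespondence A B) : Prop :=
  X.IsFull ∧ Function.Injective X.lsmul ∧ Set.range X.lsmul = (X.compacts : Set _)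

/-- A realization of the interior tensor product `X ⊗_B Y`: an `A`-`C` correspondence with a
bilinear map `(x, y) ↦ x ⊗ y` that is compatible with the actions, has
`⟨x ⊗ y, x' ⊗ y'⟩ = ⟨y, ⟨x, x'⟩ y'⟩`, and whose values span a dense subspace. In other words, it is
a completion of the quotient of the algebraic tensor product by the null vectors of this
semi-inner product, and it is unique up to a unique unitary isomorphism. (That
`x b ⊗ y = x ⊗ b y` is a consequence.) -/
structure InteriorTensor (X : CStarCorrespondence A B) (Y : CStarCorrespondence B C) where
  prod : CStarCorrespondence A C
  tmul : X.carrier →ₗ[ℂ] Y.carrier →ₗ[ℂ] prod.carrier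
  inner_tmul : ∀ x y x' y',
    prod.inner (tmul x y) (tmul x' y') = Y.inner y (Y.lsmul (X.inner x x') y')
  lsmul_tmul : ∀ a x y, prod.lsmul a (tmul x y) = tmul (X.lsmul a x) y
  rsmul_tmul : ∀ c x y, prod.rsmul c (tmul x y) = tmul x (Y.rsmul c y)
  dense : (Submodule.span ℂ {z : prod.carrier | ∃ x y, z = tmul x y}).topologicalClosure = ⊤

/-- A unitary isomorphism of correspondences: an isometric linear surjection that respects the
left and the right action. -/
def UnitarilyIsomorphic (X Y : CStarCorrespondence A B) : Prop :=
  ∃ U : X.carrier ≃ₗᵢ[ℂ] Y.carrier, ∀ (a : A) (x : X.carrier) (b : B),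
    U (X.lsmul a x) = Y.lsmul a (U x) ∧ U (X.rsmul b x) = Y.rsmul b (U x)

/-- `M` is a strong Morita equivalence between `X` and `Y`: it is an imprimitivity bimodule and
`X ⊗ M ≅ M ⊗ Y`. -/
def IsStrongMoritaEquivalence (X : CStarCorrespondence A A) (Y : CStarCorrespondence B B)
    (M : CStarCorrespondence A B) : Prop :=
  M.IsImprimitivity ∧
    ∃ (XM : InteriorTensor X M) (MY : InteriorTensor M Y), UnitarilyIsomorphic XM.prod MY.prod

end

/-- Replace the coefficient algebras of a correspondence along `*`-isomorphisms: the actions of `A'`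
and `B'` are those of the corresponding elements of `A` and `B`, and the inner product is carried
over to `B'`. -/
def changeCoeff {A B A' B' : Type v} [NonUnitalCStarAlgebra A] [NonUnitalCStarAlgebra B]
    [NonUnitalCStarAlgebra A'] [NonUnitalCStarAlgebra B'] (X : CStarCorrespondence A B)
    (α : A ≃⋆ₐ[ℂ] A') (β : B ≃⋆ₐ[ℂ] B') : CStarCorrespondence A' B' where
  carrier := X.carrier
  inner x := (β : B →ₗ[ℂ] B') ∘ₗ X.inner x
  rsmul := X.rsmul ∘ₗ (β.symm : B' →ₗ[ℂ] B)
  lsmul := X.lsmul ∘ₗ (α.symm : A' →ₗ[ℂ] A)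
  star_inner x y := by simp [← map_star, X.star_inner]
  inner_self_nonneg x := by
    obtain ⟨b, hb⟩ := X.inner_self_nonneg x
    exact ⟨β b, by simp [hb, map_star]⟩
  norm_sq x := by
    have : ‖β (X.inner x x)‖ = ‖X.inner x x‖ := NonUnitalStarAlgHom.norm_map β β.injective _
    simpa [this] using X.norm_sq x
  inner_rsmul x y b := by simp [X.inner_rsmul]
  rsmul_mul b c x := by simp [X.rsmul_mul]
  lsmul_mul a c x := by simp [X.lsmul_mul]
  inner_lsmul a x y := by simp [X.inner_lsmul, map_star]
  nondegenerate := by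
    rw [← X.nondegenerate]
    congr 2
    ext y
    constructor
    · rintro ⟨a, x, rfl⟩
      exact ⟨α.symm a, x, rfl⟩
    · rintro ⟨a, x, rfl⟩
      exact ⟨α a, x, by simp⟩

end CStarCorrespondence

/-! ### Pimsner dilations -/

namespace GraphCStar

variable {Ω : Type u} (E : ArrowGraph.{u, 0} Ω)

/-- If `a^* a` is in the core then `a^* a = b^* b` for some `b` in the core. -/
theorem exists_core_star_mul_self (hE : RowFinite E) (K : Set Ω) {a : GraphCStar E}
    (ha : star a * a ∈ core E hE K) :
    ∃ b : core E hE K, (⟨star a * a, ha⟩ : core E hE K) = star b * b := by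
  let _ := CStarAlgebra.spectralOrder (GraphCStar E)
  have _ := CStarAlgebra.spectralOrderedRing (GraphCStar E)
  have hnn : 0 ≤ star a * a := star_mul_self_nonneg a
  have hmem : CFC.sqrt (star a * a) ∈ core E hE K := by
    rw [CFC.sqrt_eq_real_sqrt _ hnn]
    exact cfcₙ_mem (𝕜' := ℂ) _ ha
  refine ⟨⟨CFC.sqrt (star a * a), hmem⟩, Subtype.ext ?_⟩
  change star a * a = star (CFC.sqrt (star a * a)) * CFC.sqrt (star a * a)
  rw [(CFC.sqrt_nonneg (star a * a)).star_eq, CFC.sqrt_mul_sqrt_self _ hnn]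

theorem P_mem_core (hE : RowFinite E) {K : Set Ω} {v : Ω} (hv : v ∈ K) : P E v ∈ core E hE K := by
  have h := isCKFamily E
  have := pathOp_mul_mem_spectral (E := E) (d := 0) (GPath.nil v) (GPath.nil v) (by simp) hv hv
  simp only [pathOp] at this
  rw [(h.isStarProjection v).isSelfAdjoint, (h.isStarProjection v).isIdempotentElem] at this
  exact this

/-- The correspondence that is the closed linear span of all `S_μ S_ν^*` with `|μ| = |ν| + 1`,
`r(μ) = r(ν)`, `s(μ) ∈ K` and `s(ν) ∈ L`, over the cores for `K` (on the left) and `L` (on the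
right). The actions are multiplication in `C*(E)`, and `⟨x, y⟩ = x^* y`. -/
def dilation (hE : RowFinite E) (K L : Set Ω) :
    CStarCorrespondence (core E hE K) (core E hE L) where
  carrier := spectral E 1 K L
  completeSpace := (Submodule.isClosed_topologicalClosure _).completeSpace_coe
  inner x :=
    { toFun := fun y => ⟨star x.1 * y.1, by
        have := spectral_mul_mem hE (spectral_star_mem x.2) y.2
        rwa [neg_add_cancel] at this⟩
      map_add' := fun y z => Subtype.ext (mul_add _ _ _)
      map_smul' := fun c y => Subtype.ext (mul_smul_comm _ _ _) }
  rsmul := LinearMap.mk₂ ℂ (fun b x => ⟨x.1 * b.1, by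
      simpa using spectral_mul_mem hE x.2 b.2⟩)
    (fun _ _ _ => Subtype.ext (mul_add _ _ _)) (fun _ _ _ => Subtype.ext (mul_smul_comm _ _ _))
    (fun _ _ _ => Subtype.ext (add_mul _ _ _)) (fun _ _ _ => Subtype.ext (smul_mul_assoc _ _ _))
  lsmul :=
    { toFun := fun a => LinearMap.mkContinuous
        { toFun := fun x => ⟨a.1 * x.1, by simpa using spectral_mul_mem hE a.2 x.2⟩
          map_add' := fun y z => Subtype.ext (mul_add _ _ _)
          map_smul' := fun c y => Subtype.ext (mul_smul_comm _ _ _) } ‖a.1‖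
        (fun x => norm_mul_le a.1 x.1)
      map_add' := fun _ _ => ContinuousLinearMap.ext fun _ => Subtype.ext (add_mul _ _ _)
      map_smul' := fun _ _ => ContinuousLinearMap.ext fun _ => Subtype.ext (smul_mul_assoc _ _ _) }
  star_inner x y := Subtype.ext (by
    change star (star x.1 * y.1) = star y.1 * x.1
    rw [star_mul, star_star])
  inner_self_nonneg x := exists_core_star_mul_self E hE L _
  norm_sq x := by
    change ‖x.1‖ ^ 2 = ‖star x.1 * x.1‖
    rw [CStarRing.norm_star_mul_self, sq]
  inner_rsmul x y b := Subtype.ext (mul_assoc _ _ _).symm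
  rsmul_mul b c x := Subtype.ext (mul_assoc _ _ _).symm
  lsmul_mul a c x := Subtype.ext (mul_assoc _ _ _)
  inner_lsmul a x y := Subtype.ext (by
    change star (a.1 * x.1) * y.1 = star x.1 * (star a.1 * y.1)
    rw [star_mul, mul_assoc])
  nondegenerate := by
    rw [eq_top_iff]
    rintro ⟨x, hx⟩ -
    set N := (Submodule.span ℂ {y : spectral E 1 K L | ∃ (a : core E hE K) (x : spectral E 1 K L),
      y = ⟨a.1 * x.1, by simpa using spectral_mul_mem hE a.2 x.2⟩}).topologicalClosure with hN
    have hNc : IsClosed (N.map (spectral E 1 K L).subtype : Set (GraphCStar E)) := by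
      have hcs : IsClosed (spectral E 1 K L : Set (GraphCStar E)) :=
        Submodule.isClosed_topologicalClosure _
      have hNs : IsClosed (N : Set (spectral E 1 K L)) := Submodule.isClosed_topologicalClosure _
      exact hcs.isClosedEmbedding_subtypeVal.isClosedMap _ hNs
    have hle : spectral E 1 K L ≤ N.map (spectral E 1 K L).subtype := by
      refine Submodule.topologicalClosure_minimal _ (Submodule.span_le.2 ?_) hNc
      rintro _ ⟨n, k, v, v', w, μ, ν, hd, hv, hv', rfl⟩
      have hg := pathOp_mul_mem_spectral μ ν hd hv hv'
      refine ⟨⟨_, hg⟩, Submodule.le_topologicalClosure _ (Submodule.subset_span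
        ⟨⟨P E v, P_mem_core E hE hv⟩, ⟨_, hg⟩, Subtype.ext ?_⟩), rfl⟩
      change _ = P E v * _
      rw [← mul_assoc, (isCKFamily E).P_mul_pathOp hE]
    obtain ⟨y, hy, hyx⟩ := hle hx
    have : y = ⟨x, hx⟩ := Subtype.ext hyx
    rw [← this]
    exact hy


/-! ### The identification of the cores induced by a path isomorphism -/

section Blocks

variable {E}

/-- For a graph `F` and a map `θ` from its edges to paths of length `m` in `E` with the same source
and range, the element `S_{θ(f₁) ⋯ θ(f_k)} = S_{θ(f₁)} ⋯ S_{θ(f_k)}` of `C*(E)` that belongs to a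
path `f₁ ⋯ f_k` in `F`. -/
def blockOp {F : ArrowGraph.{u, x} Ω} {m : ℕ} (θ : ∀ v w, F v w → GPath E m v w) {k : ℕ} {v w : Ω}
    (μ : GPath F k v w) : GraphCStar E :=
  pathOp (P E) (fun v w f => pathOp (P E) (S E) (θ v w f)) μ

theorem exists_path_of_block (hE : RowFinite E) {F : ArrowGraph.{u, x} Ω} {m : ℕ}
    (θ : ∀ v w, F v w → GPath E m v w) {k : ℕ} {v w : Ω} (μ : GPath F k v w) :
    ∃ (l : ℕ) (p : GPath E l v w), l = m * k ∧ blockOp θ μ = pathOp (P E) (S E) p := by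
  induction μ with
  | nil v => exact ⟨0, GPath.nil v, by simp, rfl⟩
  | @cons v w z k f μ ih =>
    obtain ⟨l, p, hl, hp⟩ := ih
    refine ⟨_, ((θ _ _ f).comp p).2.2, ?_, ?_⟩
    · rw [((θ _ _ f).comp p).2.1, hl]; ring
    · rw [← (isCKFamily E).pathOp_mul_pathOp hE, ← hp]; rfl

/-- The element `S_{θ(μ)} S_{θ(μ')}^*` of the core, for two paths `μ` and `μ'` in `F` of the same
length, with the same range and with sources in `K`. -/
def blockUnit (hE : RowFinite E) {F : ArrowGraph.{u, x} Ω} {m : ℕ}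
    (θ : ∀ v w, F v w → GPath E m v w) {K : Set Ω} {k : ℕ} {v v' w : Ω} (hv : v ∈ K) (hv' : v' ∈ K)
    (μ : GPath F k v w) (μ' : GPath F k v' w) : core E hE K :=
  ⟨blockOp θ μ * star (blockOp θ μ'), by
    obtain ⟨l, p, hl, hp⟩ := exists_path_of_block hE θ μ
    obtain ⟨l', p', hl', hp'⟩ := exists_path_of_block hE θ μ'
    rw [hp, hp']
    exact pathOp_mul_mem_spectral p p' (by rw [hl, hl']; simp) hv hv'⟩

end Blocks

/-- A `*`-isomorphism `Ψ` between the cores (for `K`) of `C*(E)` and `C*(F)` is induced by a path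
isomorphism `ψ : E^l → F^m` if `Ψ(T_μ T_μ'^*) = S_{ψ_k(μ)} S_{ψ_k(μ')}^*` for all paths
`μ = μ₁ ⋯ μ_k` and `μ' = μ'₁ ⋯ μ'_k` in `E` of length `l k` (with `μ_i, μ'_i` of length `l`) that
have the same range and start in `K`, where `ψ_k(μ₁ ⋯ μ_k) = ψ(μ₁) ⋯ ψ(μ_k)`. -/
def InducedBy {E F : ArrowGraph.{u, 0} Ω} (hE : RowFinite E) (hF : RowFinite F) {K : Set Ω}
    {l m : ℕ} (ψ : PathIso (GPath E l) (GPath F m)) (Ψ : core E hE K ≃⋆ₐ[ℂ] core F hF K) : Prop :=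
  ∀ (k : ℕ) (v v' w : Ω) (hv : v ∈ K) (hv' : v' ∈ K)
    (μ : GPath (GPath E l) k v w) (μ' : GPath (GPath E l) k v' w),
    Ψ (blockUnit hE (fun _ _ p => p) hv hv' μ μ') = blockUnit hF (fun v w p => ψ v w p) hv hv' μ μ'

end GraphCStar

/-! ### Row-finiteness of the graphs of `C` and `D` -/

theorem rowFinite_graphC {V W : Type u} {A : Matrix V V ℕ} {B : Matrix W W ℕ}
    (hA : A.FinitelySummingRows) (hB : B.FinitelySummingRows) : RowFinite (graphC A B) := by
  intro v
  have hfin : {w | Matrix.fromBlocks A 0 0 B v w ≠ 0}.Finite := by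
    rcases v with v | v
    · refine ((hA v).image Sum.inl).subset ?_
      rintro (w | w) hw
      · exact ⟨w, hw, rfl⟩
      · exact absurd rfl hw
    · refine ((hB v).image Sum.inr).subset ?_
      rintro (w | w) hw
      · exact absurd rfl hw
      · exact ⟨w, hw, rfl⟩
  have := hfin.to_subtype
  refine Finite.of_surjective (α := Σ w : {w | Matrix.fromBlocks A 0 0 B v w ≠ 0},
    Fin (Matrix.fromBlocks A 0 0 B v w.1)) (fun p => ⟨p.1.1, p.2⟩) ?_
  rintro ⟨w, i⟩
  have hw : Matrix.fromBlocks A 0 0 B v w ≠ 0 := by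
    intro h0
    have : Fin (Matrix.fromBlocks A 0 0 B v w) := i
    rw [h0] at this
    exact this.elim0
  exact ⟨⟨⟨w, hw⟩, i⟩, rfl⟩

theorem noSinks_graphC {V W : Type u} {A : Matrix V V ℕ} {B : Matrix W W ℕ}
    (hA : A.Essential) (hB : B.Essential) (v : V ⊕ W) : ∃ w, Nonempty (graphC A B v w) := by
  rcases v with v | v
  · obtain ⟨w, hw⟩ := hA.1 v
    exact ⟨Sum.inl w, ⟨⟨0, Nat.pos_of_ne_zero hw⟩⟩⟩
  · obtain ⟨w, hw⟩ := hB.1 v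
    exact ⟨Sum.inr w, ⟨⟨0, Nat.pos_of_ne_zero hw⟩⟩⟩

theorem finite_paths {Ω : Type u} {E : ArrowGraph.{u, x} Ω} (hE : RowFinite E) (n : ℕ) (v : Ω) :
    Finite (Σ w : Ω, GPath E n v w) := by
  induction n generalizing v with
  | zero =>
    refine Finite.of_surjective (α := Unit) (fun _ => ⟨v, GPath.nil v⟩) ?_
    rintro ⟨w, p⟩
    cases p
    exact ⟨(), rfl⟩
  | succ n ih =>
    have := hE v
    have := ih
    refine Finite.of_surjective (α := Σ e : (Σ w : Ω, E v w), Σ z : Ω, GPath E n e.1 z)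
      (fun p => ⟨p.2.1, GPath.cons p.1.2 p.2.2⟩) ?_
    rintro ⟨w, p⟩
    cases p with
    | cons e p => exact ⟨⟨⟨_, e⟩, ⟨_, p⟩⟩, rfl⟩

/-- The first edge of a path. -/
def GPath.head {Ω : Type u} {E : ArrowGraph.{u, x} Ω} :
    ∀ {n : ℕ} {v w : Ω}, GPath E (n + 1) v w → Σ z : Ω, E v z
  | _, _, _, GPath.cons e _ => ⟨_, e⟩

theorem rowFinite_of_pathIso {Ω : Type u} {E F : ArrowGraph.{u, 0} Ω} (hF : RowFinite F)
    (hsF : ∀ v, ∃ w, Nonempty (F v w)) {m : ℕ} (ψ : PathIso (GPath E 2) (GPath F m)) :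
    RowFinite E := by
  have hlong : ∀ (n : ℕ) (v : Ω), ∃ w, Nonempty (GPath F n v w) := by
    intro n
    induction n with
    | zero => exact fun v => ⟨v, ⟨GPath.nil v⟩⟩
    | succ n ih =>
      intro v
      obtain ⟨w, ⟨e⟩⟩ := hsF v
      obtain ⟨z, ⟨p⟩⟩ := ih w
      exact ⟨z, ⟨GPath.cons e p⟩⟩
  have hsE : ∀ v, Nonempty (Σ w, E v w) := by
    intro v
    obtain ⟨w, ⟨p⟩⟩ := hlong m v
    exact ⟨((ψ v w).symm p).head⟩
  intro v
  have := finite_paths hF m v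
  refine Finite.of_surjective
    (fun p : (Σ w : Ω, GPath F m v w) => ((ψ v p.1).symm p.2).head) ?_
  rintro ⟨w, e⟩
  obtain ⟨⟨z, e'⟩⟩ := hsE w
  refine ⟨⟨z, ψ v z (GPath.cons e (GPath.cons e' (GPath.nil z)))⟩, ?_⟩
  simp [GPath.head]

/-! ### Strong Morita shift equivalence -/

/-- `X(A)_∞` and `X(B)_∞` are strong Morita shift equivalent with lag `m` via `R`, `S` and `ψ`:
once the coefficient algebras of `X(R)_∞` are identified with those of `X(A)_∞` and `X(B)_∞` by the
`*`-isomorphisms that `ψ` induces, `X(R)_∞` is a strong Morita equivalence between `X(A)_∞` and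
`X(B)_∞`. Here `X(A)_∞` and `X(B)_∞` are the diagonal corners of the degree one part of `C*(G_C)`,
and `X(R)_∞` is the `V`-`W` corner of the degree one part of `C*(G_D)`. -/
def StrongMoritaShiftEquivalentVia {V W : Type u} (A : Matrix V V ℕ) (B : Matrix W W ℕ)
    (hA : A.Essential) (hB : B.Essential)
    (hA' : A.FinitelySummingRows) (hB' : B.FinitelySummingRows) (m : ℕ)
    (R : Matrix V W ℕ) (S : Matrix W V ℕ)
    (ψ : PathIso (GPath (graphD R S) 2) (GPath (graphC A B) m)) : Prop :=
  let hC : RowFinite (graphC A B) := rowFinite_graphC hA' hB'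
  let hD : RowFinite (graphD R S) := rowFinite_of_pathIso hC (noSinks_graphC hA hB) ψ
  ∃ (ΨA : GraphCStar.core (graphD R S) hD (partV V W) ≃⋆ₐ[ℂ]
        GraphCStar.core (graphC A B) hC (partV V W))
    (ΨB : GraphCStar.core (graphD R S) hD (partW V W) ≃⋆ₐ[ℂ]
        GraphCStar.core (graphC A B) hC (partW V W)),
    GraphCStar.InducedBy hD hC ψ ΨA ∧ GraphCStar.InducedBy hD hC ψ ΨB ∧
    CStarCorrespondence.IsStrongMoritaEquivalence
      (GraphCStar.dilation (graphC A B) hC (partV V W) (partV V W))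
      (GraphCStar.dilation (graphC A B) hC (partW V W) (partW V W))
      ((GraphCStar.dilation (graphD R S) hD (partV V W) (partW V W)).changeCoeff ΨA ΨB)

end

/-! A representation as in the hypothesis gives homomorphisms `ρC` and `ρD` of the two graph
algebras into one C*-algebra `𝔅` that agree on the vertex projections and kill none of them.
Everything is compared inside `𝔅`.

Such a homomorphism is isometric on the core (`norm_map_core`). The graphs are row-finite without
sinks, so the core is the closure of an increasing union of spans of matrix units S_μ S_ν^* with |μ|
= |ν| = n, and an element of such a span is recovered from its coefficients, which are multiples of
vertex projections. By the C*-identity the degree one correspondences are then represented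
isometrically too. The relation between `ψ` and the operators says that a path of length 2k in D and
the corresponding path of length mk in C have the same image. These lengths suffice to span the
cores densely, so for each of V and W the two cores have the same image in `𝔅` (`map_core_subset`),
and Ψ is ρC⁻¹ ρD (`exists_core_equiv`).

That X = X(R)_∞ is an imprimitivity bimodule is a statement about D alone
(`dilation_isImprimitivity`). All edges of D from V end in W and every vertex of W receives one, so
the products X X^* and X^* X span dense subspaces of the two cores. An element x y^* acts on X as a
rank one operator, and the left action is isometric by an estimate on powers
(`norm_le_of_forall_norm_mul_le`); hence its range is exactly the compacts.

The interior tensor product of two correspondences represented in `𝔅` is the closed span of their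
products (`InteriorTensor.ofRepresentation`). So U may be taken to be the identity once X(A)_∞
X(R)_∞ and X(R)_∞ X(B)_∞ have the same closed span in `𝔅`. Each of these spaces is spanned by edges
times core elements (`spectral_one_le`); core elements pass from one graph to the other because the
images of the cores coincide, and `φ` interchanges the edges (`map_mul_map_mem`). -/

noncomputable section

/-! ### Closed spans and `*`-homomorphisms -/

/-- A closed subspace that contains the image of a spanning set contains the image of its closed
span. -/
theorem map_mem_of_mem_closure_span {X Y : Type*} [NormedAddCommGroup X] [NormedSpace ℂ X]
    [NormedAddCommGroup Y] [NormedSpace ℂ Y] {s : Set X} {f : X → Y} (hf : Continuous f)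
    (hadd : ∀ x y, f (x + y) = f x + f y) (hsmul : ∀ (c : ℂ) x, f (c • x) = c • f x)
    {N : Submodule ℂ Y} (hN : IsClosed (N : Set Y)) (h : ∀ x ∈ s, f x ∈ N) {x : X}
    (hx : x ∈ (Submodule.span ℂ s).topologicalClosure) : f x ∈ N := by
  -- Linearity is assumed of a plain function so that maps such as z ↦ z * c can be supplied without
  -- bundling.
  let g : X →ₗ[ℂ] Y := ⟨⟨f, hadd⟩, hsmul⟩
  have hle : (Submodule.span ℂ s).topologicalClosure ≤ N.comap g :=
    Submodule.topologicalClosure_minimal _ (Submodule.span_le.2 h) (hN.preimage hf)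
  exact hle hx

theorem isClosed_range_of_norm_eq {X Y F : Type*} [NormedAddCommGroup X] [CompleteSpace X]
    [NormedAddCommGroup Y] [FunLike F X Y] [AddMonoidHomClass F X Y] (f : F)
    (hf : ∀ x, ‖f x‖ = ‖x‖) : IsClosed (Set.range f) :=
  (AddMonoidHomClass.isometry_of_norm f hf).isClosedEmbedding.isClosed_range

theorem continuous_starHom {A B : Type*} [NonUnitalCStarAlgebra A] [NonUnitalCStarAlgebra B]
    (ρ : A →⋆ₙₐ[ℂ] B) : Continuous ρ :=
  AddMonoidHomClass.continuous_of_bound ρ 1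
    fun a => by simpa using NonUnitalStarAlgHom.norm_apply_le ρ a

/-! ### Concatenating and cutting paths in a Cuntz-Krieger family -/

section CKFacts

variable {Ω : Type u} {E : ArrowGraph.{u, x} Ω} {𝔄 : Type v} [NonUnitalCStarAlgebra 𝔄]
  {P : Ω → 𝔄} {S : ∀ ⦃v w : Ω⦄, E v w → 𝔄}

theorem IsCKFamily.P_mul_P (h : IsCKFamily E P S) (v : Ω) : P v * P v = P v :=
  (h.isStarProjection v).isIdempotentElem

theorem IsCKFamily.star_P (h : IsCKFamily E P S) (v : Ω) : star (P v) = P v :=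
  (h.isStarProjection v).isSelfAdjoint

theorem IsCKFamily.pathOp_mul_P (h : IsCKFamily E P S) {n : ℕ} {v w : Ω} (p : GPath E n v w) :
    pathOp P S p * P w = pathOp P S p := by
  induction p with
  | nil v => exact h.P_mul_P v
  | cons e p ih => simp only [pathOp]; rw [mul_assoc, ih]

theorem IsCKFamily.pathOp_single (h : IsCKFamily E P S) {v w : Ω} (e : E v w) :
    pathOp P S (GPath.cons e (GPath.nil w)) = S e := h.S_mul_P e

theorem IsCKFamily.star_pathOp_mul_self (h : IsCKFamily E P S) (hE : RowFinite E) {n : ℕ}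
    {v w : Ω} (p : GPath E n v w) : star (pathOp P S p) * pathOp P S p = P w := by
  induction p with
  | nil v => simp only [pathOp]; rw [h.star_P, h.P_mul_P]
  | cons e p ih =>
    simp only [pathOp, star_mul]
    rw [mul_assoc, ← mul_assoc (star (S e)), h.star_mul_self, h.P_mul_pathOp hE, ih]

theorem IsCKFamily.exists_pathOp_comp (h : IsCKFamily E P S) (hE : RowFinite E) {n k : ℕ}
    {v w z : Ω} (p : GPath E n v w) (q : GPath E k w z) :
    ∃ r : GPath E (n + k) v z, pathOp P S r = pathOp P S p * pathOp P S q := by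
  have := h.pathOp_mul_pathOp hE p q
  generalize p.comp q = c at this
  obtain ⟨l, rfl, r⟩ := c
  exact ⟨r, this.symm⟩

theorem IsCKFamily.exists_pathOp_split (h : IsCKFamily E P S) (hE : RowFinite E) (n : ℕ) {k l : ℕ}
    (hl : l = n + k) {v z : Ω} (p : GPath E l v z) :
    ∃ (w : Ω) (q : GPath E n v w) (r : GPath E k w z),
      pathOp P S p = pathOp P S q * pathOp P S r := by
  subst hl
  induction n generalizing v with
  | zero =>
    have hk : 0 + k = k := Nat.zero_add k
    revert p
    rw [hk]
    intro p
    exact ⟨v, GPath.nil v, p, (h.P_mul_pathOp hE p).symm⟩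
  | succ n ih =>
    have hk : n + 1 + k = (n + k) + 1 := by omega
    revert p
    rw [hk]
    intro p
    cases p with
    | cons e p =>
      obtain ⟨w, q, r, hqr⟩ := ih p
      exact ⟨w, GPath.cons e q, r, by simp only [pathOp]; rw [hqr, mul_assoc]⟩

end CKFacts

namespace GraphCStar

variable {Ω : Type u} {E : ArrowGraph.{u, 0} Ω}

/-! ### Matrix units in the core -/

/-- The span of the `S_μ S_ν^*` with `μ` and `ν` in a set `J` of paths of length `n`. -/
def matrixSpan {n : ℕ} (J : Set (Σ v w : Ω, GPath E n v w)) : Submodule ℂ (GraphCStar E) :=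
  Submodule.span ℂ {a | ∃ μ ∈ J, ∃ ν ∈ J, μ.2.1 = ν.2.1 ∧
    a = pathOp (P E) (S E) μ.2.2 * star (pathOp (P E) (S E) ν.2.2)}

theorem matrixSpan_mono {n : ℕ} {J J' : Set (Σ v w : Ω, GPath E n v w)} (h : J ⊆ J') :
    matrixSpan J ≤ matrixSpan J' :=
  Submodule.span_mono (by rintro _ ⟨μ, hμ, ν, hν, h', rfl⟩; exact ⟨μ, h hμ, ν, h hν, h', rfl⟩)

theorem eq_and_pathOp_eq_of_length_zero {v w : Ω} (p : GPath E 0 v w) :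
    v = w ∧ pathOp (P E) (S E) p = P E v := by
  cases p
  exact ⟨rfl, rfl⟩

/-- For paths of equal length the path left over after cancellation has length 0, so it is a vertex.
These are the relations of matrix units. -/
theorem star_pathOp_mul_pathOp (hE : RowFinite E) {n : ℕ} (μ ν : Σ v w : Ω, GPath E n v w) :
    star (pathOp (P E) (S E) μ.2.2) * pathOp (P E) (S E) ν.2.2 = 0 ∨
      (μ.2.1 = ν.2.1 ∧
        star (pathOp (P E) (S E) μ.2.2) * pathOp (P E) (S E) ν.2.2 = P E μ.2.1) := by
  rcases (isCKFamily E).star_pathOp_mul hE μ.2.2 ν.2.2 le_rfl with h0 | ⟨l, r, hl, hr⟩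
  · exact Or.inl h0
  · obtain rfl : l = 0 := by omega
    right
    rw [hr]
    exact eq_and_pathOp_eq_of_length_zero r

theorem matrixSpan_star_mem {n : ℕ} {J : Set (Σ v w : Ω, GPath E n v w)} {a : GraphCStar E}
    (ha : a ∈ matrixSpan J) : star a ∈ matrixSpan J := by
  induction ha using Submodule.span_induction with
  | mem a h =>
    obtain ⟨μ, hμ, ν, hν, h', rfl⟩ := h
    rw [star_mul, star_star]
    exact Submodule.subset_span ⟨ν, hν, μ, hμ, h'.symm, rfl⟩
  | zero => simp
  | add x y _ _ hx hy => rw [star_add]; exact add_mem hx hy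
  | smul c x _ hx => rw [star_smul]; exact Submodule.smul_mem _ _ hx

theorem matrixSpan_mul_mem (hE : RowFinite E) {n : ℕ} {J : Set (Σ v w : Ω, GPath E n v w)}
    {a b : GraphCStar E} (ha : a ∈ matrixSpan J) (hb : b ∈ matrixSpan J) :
    a * b ∈ matrixSpan J := by
  induction ha using Submodule.span_induction with
  | mem a h =>
    obtain ⟨μ, hμ, ν, hν, h', rfl⟩ := h
    induction hb using Submodule.span_induction with
    | mem b h =>
      obtain ⟨μ₂, hμ₂, ν₂, hν₂, h₂, rfl⟩ := h
      rw [mul_assoc, ← mul_assoc (star _)]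
      rcases star_pathOp_mul_pathOp hE ν μ₂ with h0 | ⟨h1, h0⟩
      · rw [h0]; simp
      · rw [h0, ← h', ← mul_assoc, (isCKFamily E).pathOp_mul_P]
        exact Submodule.subset_span ⟨μ, hμ, ν₂, hν₂, by rw [h', h1, h₂], rfl⟩
    | zero => simp
    | add x y _ _ hx hy => rw [mul_add]; exact add_mem hx hy
    | smul c x _ hx => rw [mul_smul_comm]; exact Submodule.smul_mem _ _ hx
  | zero => simp
  | add x y _ _ hx hy => rw [add_mul]; exact add_mem hx hy
  | smul c x _ hx => rw [smul_mul_assoc]; exact Submodule.smul_mem _ _ hx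

/-- The `*`-algebra of the matrix units for a set of paths of the same length. -/
def matrixAlgebra (hE : RowFinite E) {n : ℕ} (J : Set (Σ v w : Ω, GPath E n v w)) :
    NonUnitalStarSubalgebra ℂ (GraphCStar E) where
  carrier := matrixSpan J
  add_mem' ha hb := add_mem ha hb
  zero_mem' := zero_mem _
  smul_mem' c _ ha := Submodule.smul_mem _ c ha
  mul_mem' ha hb := matrixSpan_mul_mem hE ha hb
  star_mem' ha := matrixSpan_star_mem ha

/-- Finitely many matrix units span a finite-dimensional space. Closedness turns `matrixAlgebra`
into a C*-algebra, so that injective homomorphisms on it are isometric. -/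
theorem isClosed_matrixSpan {n : ℕ} {J : Set (Σ v w : Ω, GPath E n v w)} (hJ : J.Finite) :
    IsClosed (matrixSpan J : Set (GraphCStar E)) := by
  have hfin : {a | ∃ μ ∈ J, ∃ ν ∈ J, μ.2.1 = ν.2.1 ∧
      a = pathOp (P E) (S E) μ.2.2 * star (pathOp (P E) (S E) ν.2.2)}.Finite := by
    refine (Set.Finite.image2 (fun μ ν : Σ v w : Ω, GPath E n v w =>
      pathOp (P E) (S E) μ.2.2 * star (pathOp (P E) (S E) ν.2.2)) hJ hJ).subset ?_
    rintro _ ⟨μ, hμ, ν, hν, -, rfl⟩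
    exact ⟨μ, hμ, ν, hν, rfl⟩
  have : FiniteDimensional ℂ (matrixSpan J) := FiniteDimensional.span_of_finite ℂ hfin
  exact Submodule.closed_of_finiteDimensional _

/-- The matrix units are separated by any homomorphism that does not kill the vertices. -/
theorem eq_zero_of_map_eq_zero (hE : RowFinite E) {𝔅 : Type v} [NonUnitalCStarAlgebra 𝔅]
    (ρ : GraphCStar E →⋆ₙₐ[ℂ] 𝔅) (h0 : ∀ v, ρ (P E v) ≠ 0) {n : ℕ}
    {J : Set (Σ v w : Ω, GPath E n v w)} {a : GraphCStar E} (ha : a ∈ matrixSpan J)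
    (hρ : ρ a = 0) : a = 0 := by
  -- Compressing by two paths of length n picks out one matrix coefficient of `a`, as a multiple of
  -- a vertex projection.
  have hscalar : ∀ μ ν : Σ v w : Ω, GPath E n v w, ∃ c : ℂ,
      star (pathOp (P E) (S E) μ.2.2) * a * pathOp (P E) (S E) ν.2.2 = c • P E μ.2.1 := by
    intro μ ν
    clear hρ
    induction ha using Submodule.span_induction with
    | mem a h =>
      obtain ⟨α, -, β, -, hαβ, rfl⟩ := h
      have hrw : star (pathOp (P E) (S E) μ.2.2) *
          (pathOp (P E) (S E) α.2.2 * star (pathOp (P E) (S E) β.2.2)) * pathOp (P E) (S E) ν.2.2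
          = (star (pathOp (P E) (S E) μ.2.2) * pathOp (P E) (S E) α.2.2) *
            (star (pathOp (P E) (S E) β.2.2) * pathOp (P E) (S E) ν.2.2) := by
        simp only [mul_assoc]
      rw [hrw]
      rcases star_pathOp_mul_pathOp hE μ α with h1 | ⟨h1', h1⟩
      · exact ⟨0, by rw [h1]; simp⟩
      rcases star_pathOp_mul_pathOp hE β ν with h2 | ⟨-, h2⟩
      · exact ⟨0, by rw [h2]; simp⟩
      · exact ⟨1, by rw [h1, h2, ← hαβ, ← h1', (isCKFamily E).P_mul_P, one_smul]⟩
    | zero => exact ⟨0, by simp⟩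
    | add x y _ _ hx hy =>
      obtain ⟨c, hc⟩ := hx
      obtain ⟨d, hd⟩ := hy
      exact ⟨c + d, by rw [mul_add, add_mul, hc, hd, add_smul]⟩
    | smul r x _ hx =>
      obtain ⟨c, hc⟩ := hx
      exact ⟨r * c, by rw [mul_smul_comm, smul_mul_assoc, hc, smul_smul]⟩
  -- The image of the vertex projection is not zero, so `ρ a = 0` forces the coefficient to vanish.
  have hzero : ∀ μ ν : Σ v w : Ω, GPath E n v w,
      star (pathOp (P E) (S E) μ.2.2) * a * pathOp (P E) (S E) ν.2.2 = 0 := by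
    intro μ ν
    obtain ⟨c, hc⟩ := hscalar μ ν
    have := congrArg ρ hc
    rw [map_mul, map_mul, hρ, mul_zero, zero_mul, map_smul] at this
    rw [hc, (smul_eq_zero.1 this.symm).resolve_right (h0 _), zero_smul]
  have hmul : ∀ b ∈ matrixSpan J, ∀ c ∈ matrixSpan J, b * a * c = 0 := by
    intro b hb c hc
    induction hb using Submodule.span_induction with
    | mem b h =>
      obtain ⟨μ, -, ν, -, -, rfl⟩ := h
      induction hc using Submodule.span_induction with
      | mem c h =>
        obtain ⟨μ₂, -, ν₂, -, -, rfl⟩ := h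
        have := hzero ν μ₂
        rw [← mul_assoc, mul_assoc (pathOp _ _ μ.2.2), mul_assoc (pathOp _ _ μ.2.2), this]
        simp
      | zero => simp
      | add x y _ _ hx hy => rw [mul_add, hx, hy, add_zero]
      | smul r x _ hx => rw [mul_smul_comm, hx, smul_zero]
    | zero => simp
    | add x y _ _ hx hy => rw [add_mul, add_mul, hx, hy, add_zero]
    | smul r x _ hx => rw [smul_mul_assoc, smul_mul_assoc, hx, smul_zero]
  -- With `b = c = star a` this is a^* a a^* = 0, and the C*-identity used twice gives `a = 0`.
  have h1 := hmul _ (matrixSpan_star_mem ha) _ (matrixSpan_star_mem ha)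
  have h2 : star (star a * a) * (star a * a) = 0 := by
    rw [star_mul, star_star, ← mul_assoc, h1, zero_mul]
  exact (CStarRing.star_mul_self_eq_zero_iff _).1 ((CStarRing.star_mul_self_eq_zero_iff _).1 h2)

/-- An element of the span involves only finitely many paths, hence lies in a finite-dimensional
C*-algebra on which `ρ` is injective. -/
theorem norm_map_matrixSpan (hE : RowFinite E) {𝔅 : Type v} [NonUnitalCStarAlgebra 𝔅]
    (ρ : GraphCStar E →⋆ₙₐ[ℂ] 𝔅) (h0 : ∀ v, ρ (P E v) ≠ 0) {n : ℕ}
    {J : Set (Σ v w : Ω, GPath E n v w)} {a : GraphCStar E} (ha : a ∈ matrixSpan J) :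
    ‖ρ a‖ = ‖a‖ := by
  obtain ⟨J', hJ', haJ⟩ : ∃ J' : Set (Σ v w : Ω, GPath E n v w), J'.Finite ∧
      a ∈ matrixSpan J' := by
    induction ha using Submodule.span_induction with
    | mem a h =>
      obtain ⟨μ, -, ν, -, h', rfl⟩ := h
      exact ⟨{μ, ν}, Set.toFinite _, Submodule.subset_span ⟨μ, by simp, ν, by simp, h', rfl⟩⟩
    | zero => exact ⟨∅, Set.finite_empty, zero_mem _⟩
    | add x y _ _ hx hy =>
      obtain ⟨J₁, hJ₁, hx⟩ := hx
      obtain ⟨J₂, hJ₂, hy⟩ := hy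
      exact ⟨J₁ ∪ J₂, hJ₁.union hJ₂, add_mem (matrixSpan_mono Set.subset_union_left hx)
        (matrixSpan_mono Set.subset_union_right hy)⟩
    | smul r x _ hx =>
      obtain ⟨J₁, hJ₁, hx⟩ := hx
      exact ⟨J₁, hJ₁, Submodule.smul_mem _ _ hx⟩
  have hcl : IsClosed (matrixAlgebra hE J' : Set (GraphCStar E)) := isClosed_matrixSpan hJ'
  let φ : matrixAlgebra hE J' →⋆ₙₐ[ℂ] 𝔅 :=
    ρ.comp (NonUnitalStarSubalgebraClass.subtype (matrixAlgebra hE J'))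
  have hφ : Function.Injective φ := by
    refine (injective_iff_map_eq_zero φ).2 fun b hb => Subtype.ext ?_
    exact eq_zero_of_map_eq_zero hE ρ h0 b.2 hb
  exact NonUnitalStarAlgHom.norm_map φ hφ ⟨a, haJ⟩

/-- The paths of length `n` that start in `K`. -/
def pathsFrom (E : ArrowGraph.{u, 0} Ω) (n : ℕ) (K : Set Ω) : Set (Σ v w : Ω, GPath E n v w) :=
  {μ | μ.1 ∈ K}

theorem pathOp_mul_star_mem_matrixSpan {n : ℕ} {K : Set Ω} {v v' w : Ω} (μ : GPath E n v w)
    (ν : GPath E n v' w) (hv : v ∈ K) (hv' : v' ∈ K) :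
    pathOp (P E) (S E) μ * star (pathOp (P E) (S E) ν) ∈ matrixSpan (pathsFrom E n K) :=
  Submodule.subset_span ⟨⟨v, w, μ⟩, hv, ⟨v', w, ν⟩, hv', rfl, rfl⟩

/-- Inserting the Cuntz-Krieger relation at the common range w gives S_μ S_ν^* = ∑ S_{μe} S_{νe}^*,
summed over the edges e from w. It needs w to emit an edge, and only finitely many. -/
theorem matrixSpan_le_succ (hE : RowFinite E) (hs : ∀ v, Nonempty (Σ w : Ω, E v w)) (n : ℕ)
    (K : Set Ω) : matrixSpan (pathsFrom E n K) ≤ matrixSpan (pathsFrom E (n + 1) K) := by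
  refine Submodule.span_le.2 ?_
  rintro _ ⟨⟨v, w, μ⟩, hv, ⟨v', w', ν⟩, hv', rfl, rfl⟩
  have h := isCKFamily E
  have := hE w
  let _ := Fintype.ofFinite (Σ z : Ω, E w z)
  have hsum := h.sum_eq w (hE w) (hs w)
  rw [finsum_eq_sum_of_fintype] at hsum
  simp only [SetLike.mem_coe]
  rw [← h.pathOp_mul_P μ, ← hsum, Finset.mul_sum, Finset.sum_mul]
  refine Submodule.sum_mem _ fun e _ => ?_
  obtain ⟨p, hp⟩ := h.exists_pathOp_comp hE μ (GPath.cons e.2 (GPath.nil e.1))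
  obtain ⟨q, hq⟩ := h.exists_pathOp_comp hE ν (GPath.cons e.2 (GPath.nil e.1))
  rw [h.pathOp_single] at hp hq
  have hpq := pathOp_mul_star_mem_matrixSpan p q hv hv'
  rw [hp, hq, star_mul] at hpq
  rw [mul_assoc, ← mul_assoc (S E e.2)] at hpq
  rw [mul_assoc]
  exact hpq

theorem matrixSpan_monotone (hE : RowFinite E) (hs : ∀ v, Nonempty (Σ w : Ω, E v w))
    (K : Set Ω) : Monotone fun n => matrixSpan (pathsFrom E n K) :=
  monotone_nat_of_le_succ fun n => matrixSpan_le_succ hE hs n K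

/-- In the core, paths whose length is a multiple of `l` suffice. -/
theorem core_le_closure_iSup (hE : RowFinite E) (hs : ∀ v, Nonempty (Σ w : Ω, E v w))
    (K : Set Ω) {l : ℕ} (hl : l ≠ 0) :
    spectral E 0 K K ≤ (⨆ n, matrixSpan (pathsFrom E (l * n) K)).topologicalClosure := by
  refine Submodule.topologicalClosure_mono (Submodule.span_le.2 ?_)
  rintro _ ⟨n, k, v, v', w, μ, ν, hnk, hv, hv', rfl⟩
  obtain rfl : n = k := by omega
  -- Length n may be raised to l * n, since n ≤ l * n for l ≠ 0.
  exact Submodule.mem_iSup_of_mem n (matrixSpan_monotone hE hs K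
    (Nat.le_mul_of_pos_left n (Nat.pos_of_ne_zero hl)) (pathOp_mul_star_mem_matrixSpan μ ν hv hv'))

/-- A homomorphism that does not kill the vertices is isometric on the core. -/
theorem norm_map_core (hE : RowFinite E) (hs : ∀ v, Nonempty (Σ w : Ω, E v w)) {𝔅 : Type v}
    [NonUnitalCStarAlgebra 𝔅] (ρ : GraphCStar E →⋆ₙₐ[ℂ] 𝔅) (h0 : ∀ v, ρ (P E v) ≠ 0) {K : Set Ω}
    {a : GraphCStar E} (ha : a ∈ spectral E 0 K K) : ‖ρ a‖ = ‖a‖ := by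
  have hρ : Continuous ρ := continuous_starHom ρ
  have hcl : IsClosed {a : GraphCStar E | ‖ρ a‖ = ‖a‖} :=
    isClosed_eq (continuous_norm.comp hρ) continuous_norm
  refine closure_minimal (fun a ha => ?_) hcl (core_le_closure_iSup hE hs K one_ne_zero ha)
  have hmono : Monotone fun n => matrixSpan (pathsFrom E (1 * n) K) := fun _ _ h =>
    matrixSpan_monotone hE hs K (Nat.mul_le_mul_left 1 h)
  change a ∈ ⨆ n, matrixSpan (pathsFrom E (1 * n) K) at ha
  rw [Submodule.mem_iSup_of_directed _ hmono.directed_le] at ha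
  obtain ⟨n, hn⟩ := ha
  exact norm_map_matrixSpan hE ρ h0 hn

/-! ### Blocks of paths -/

theorem exists_block_of_path (hE : RowFinite E) {l k j : ℕ} (hj : j = l * k) {v w : Ω}
    (p : GPath E j v w) : ∃ μ : GPath (GPath E l) k v w,
      blockOp (fun _ _ q => q) μ = pathOp (P E) (S E) p := by
  have h := isCKFamily E
  induction k generalizing v j with
  | zero =>
    obtain rfl : j = 0 := by simpa using hj
    cases p
    exact ⟨GPath.nil _, rfl⟩
  | succ k ih =>
    obtain ⟨z, q, r, hqr⟩ := h.exists_pathOp_split hE l (k := l * k) (by rw [hj]; ring) p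
    obtain ⟨μ, hμ⟩ := ih rfl r
    refine ⟨GPath.cons q μ, ?_⟩
    rw [hqr, ← hμ]
    rfl

/-- The core is the closed span of its elements that belong to paths of blocks. -/
theorem core_le_closure_span_block (hE : RowFinite E) (hs : ∀ v, Nonempty (Σ w : Ω, E v w))
    (K : Set Ω) {l : ℕ} (hl : l ≠ 0) :
    spectral E 0 K K ≤ (Submodule.span ℂ {a : GraphCStar E | ∃ (k : ℕ) (v v' w : Ω)
      (μ : GPath (GPath E l) k v w) (μ' : GPath (GPath E l) k v' w), v ∈ K ∧ v' ∈ K ∧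
      a = blockOp (fun _ _ q => q) μ * star (blockOp (fun _ _ q => q) μ')}).topologicalClosure := by
  refine (core_le_closure_iSup hE hs K hl).trans
    (Submodule.topologicalClosure_mono (iSup_le fun n => Submodule.span_le.2 ?_))
  rintro _ ⟨⟨v, w, μ⟩, hv, ⟨v', w', ν⟩, hv', rfl, rfl⟩
  obtain ⟨p, hp⟩ := exists_block_of_path hE rfl μ
  obtain ⟨q, hq⟩ := exists_block_of_path hE rfl ν
  exact Submodule.subset_span ⟨n, v, v', w, p, q, hv, hv', by rw [hp, hq]⟩

/-! ### The cores of two graphs inside one C*-algebra -/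

section Comparison

variable {F : ArrowGraph.{u, 0} Ω} {𝔅 : Type v} [NonUnitalCStarAlgebra 𝔅]
  {ρE : GraphCStar E →⋆ₙₐ[ℂ] 𝔅} {ρF : GraphCStar F →⋆ₙₐ[ℂ] 𝔅}

theorem map_blockOp_eq (hP : ∀ v, ρE (P E v) = ρF (P F v)) {l m : ℕ}
    {θ : ∀ v w, GPath E l v w → GPath F m v w}
    (hθ : ∀ v w (p : GPath E l v w),
      ρE (pathOp (P E) (S E) p) = ρF (pathOp (P F) (S F) (θ v w p)))
    {k : ℕ} {v w : Ω} (μ : GPath (GPath E l) k v w) :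
    ρE (blockOp (fun _ _ q => q) μ) = ρF (blockOp θ μ) := by
  induction μ with
  | nil v => exact hP v
  | cons p μ ih =>
    change ρE (pathOp (P E) (S E) p * blockOp (fun _ _ q => q) μ) =
      ρF (pathOp (P F) (S F) (θ _ _ p) * blockOp θ μ)
    rw [map_mul, map_mul, hθ, ih]

/-- A product of blocks in `E` has the same image as the product of their `θ`-images in `F`, and
such products span the core of `E` densely. Only block lengths l ≠ 0 reach the whole core. -/
theorem map_core_subset (hE : RowFinite E) (hF : RowFinite F)
    (hsE : ∀ v, Nonempty (Σ w : Ω, E v w)) (hsF : ∀ v, Nonempty (Σ w : Ω, F v w))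
    (hP : ∀ v, ρE (P E v) = ρF (P F v)) (h0 : ∀ v, ρF (P F v) ≠ 0) {l m : ℕ} (hl : l ≠ 0)
    {θ : ∀ v w, GPath E l v w → GPath F m v w}
    (hθ : ∀ v w (p : GPath E l v w),
      ρE (pathOp (P E) (S E) p) = ρF (pathOp (P F) (S F) (θ v w p)))
    {K : Set Ω} {a : GraphCStar E} (ha : a ∈ spectral E 0 K K) :
    ∃ b ∈ spectral F 0 K K, ρF b = ρE a := by
  let φ : spectral F 0 K K →ₗ[ℂ] 𝔅 := (ρF : GraphCStar F →ₗ[ℂ] 𝔅) ∘ₗ (spectral F 0 K K).subtype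
  have hφ : ∀ b, ‖φ b‖ = ‖b‖ := fun b => norm_map_core hF hsF ρF h0 b.2
  have : CompleteSpace (spectral F 0 K K) :=
    (Submodule.isClosed_topologicalClosure _).completeSpace_coe
  -- The image of the core of `F` is closed because `ρF` is isometric there, so dense generators are
  -- enough.
  have hcl : IsClosed (LinearMap.range φ : Set 𝔅) := by
    rw [LinearMap.coe_range]; exact isClosed_range_of_norm_eq φ hφ
  have key : ρE a ∈ LinearMap.range φ := by
    refine map_mem_of_mem_closure_span (continuous_starHom ρE) (map_add ρE) (map_smul ρE) hcl ?_
      (core_le_closure_span_block hE hsE K hl ha)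
    rintro _ ⟨k, v, v', w, μ, μ', hv, hv', rfl⟩
    refine ⟨blockUnit hF θ hv hv' μ μ', ?_⟩
    change ρF (blockOp θ μ * star (blockOp θ μ')) = _
    rw [map_mul, map_mul, map_star, map_star, map_blockOp_eq hP hθ, map_blockOp_eq hP hθ]
  obtain ⟨b, hb⟩ := key
  exact ⟨b.1, b.2, hb⟩

end Comparison

end GraphCStar

/-- Two injective `*`-homomorphisms with the same range induce a `*`-isomorphism. -/
theorem exists_starAlgEquiv_of_range_eq {A B 𝔅 : Type*} [NonUnitalCStarAlgebra A]
    [NonUnitalCStarAlgebra B] [NonUnitalCStarAlgebra 𝔅] (α : A →⋆ₙₐ[ℂ] 𝔅) (β : B →⋆ₙₐ[ℂ] 𝔅)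
    (hα : Function.Injective α) (hβ : Function.Injective β) (hαβ : ∀ a, ∃ b, β b = α a)
    (hβα : ∀ b, ∃ a, α a = β b) : ∃ Ψ : A ≃⋆ₐ[ℂ] B, ∀ a, β (Ψ a) = α a := by
  choose f hf using hαβ
  let g : A →⋆ₙₐ[ℂ] B :=
    { toFun := f
      map_smul' := fun c a => hβ (by simp [hf])
      map_zero' := hβ (by simp [hf])
      map_add' := fun a b => hβ (by simp [hf])
      map_mul' := fun a b => hβ (by simp [hf])
      map_star' := fun a => hβ (by simp [hf, map_star]) }
  have hg : Function.Bijective g := by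
    refine ⟨fun a b hab => hα ?_, fun b => ?_⟩
    · rw [← hf a, ← hf b]; exact congrArg β hab
    · obtain ⟨a, ha⟩ := hβα b
      exact ⟨a, hβ ((hf a).trans ha)⟩
  exact ⟨StarAlgEquiv.ofBijective g hg, hf⟩

/-! ### Correspondences represented in a C*-algebra and their tensor products -/

namespace CStarCorrespondence

section Concrete

variable {A B C 𝔅 : Type v} [NonUnitalCStarAlgebra A] [NonUnitalCStarAlgebra B]
  [NonUnitalCStarAlgebra C] [NonUnitalCStarAlgebra 𝔅]

/-- If `z^* z` is in the range of an injective `*`-homomorphism, then it is the image of some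
`c^* c`. -/
theorem exists_map_star_mul_self (γ : C →⋆ₙₐ[ℂ] 𝔅) (hγ : Function.Injective γ) {z : 𝔅} {c₀ : C}
    (hz : γ c₀ = star z * z) : ∃ c, γ (star c * c) = star z * z := by
  let _ := CStarAlgebra.spectralOrder 𝔅
  have _ := CStarAlgebra.spectralOrderedRing 𝔅
  have hnn : 0 ≤ star z * z := star_mul_self_nonneg z
  -- A closed `*`-subalgebra is stable under the continuous functional calculus, so the square root
  -- of z^* z stays in the range.
  have hcl : IsClosed (NonUnitalStarAlgHom.range γ : Set 𝔅) := by
    rw [NonUnitalStarAlgHom.coe_range]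
    exact isClosed_range_of_norm_eq γ (NonUnitalStarAlgHom.norm_map γ hγ)
  have hmem : CFC.sqrt (star z * z) ∈ NonUnitalStarAlgHom.range γ := by
    rw [CFC.sqrt_eq_real_sqrt _ hnn]
    exact cfcₙ_mem (𝕜' := ℂ) _ ⟨c₀, hz⟩
  obtain ⟨c, hc⟩ := hmem
  refine ⟨c, ?_⟩
  have hc' : γ c = CFC.sqrt (star z * z) := hc
  rw [map_mul, map_star, hc', (CFC.sqrt_nonneg (star z * z)).star_eq,
    CFC.sqrt_mul_sqrt_self _ hnn]

/-- A closed subspace `Z` of a C*-algebra as a correspondence between C*-algebras `A` and `C` that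
act on it by multiplication through `α` and `γ`, where `γ` is injective and `Z^* Z ⊆ γ(C)`. -/
def ofSubspace (Z : Submodule ℂ 𝔅) (hZ : IsClosed (Z : Set 𝔅)) (α : A →⋆ₙₐ[ℂ] 𝔅)
    (γ : C →⋆ₙₐ[ℂ] 𝔅) (hγ : Function.Injective γ)
    (hin : ∀ z ∈ Z, ∀ z' ∈ Z, star z * z' ∈ Set.range γ)
    (hl : ∀ a, ∀ z ∈ Z, α a * z ∈ Z) (hr : ∀ c, ∀ z ∈ Z, z * γ c ∈ Z)
    (hnd : Z ≤ (Submodule.span ℂ {y | ∃ a, ∃ z ∈ Z, y = α a * z}).topologicalClosure) :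
    CStarCorrespondence A C where
  carrier := Z
  completeSpace := hZ.completeSpace_coe
  inner z :=
    -- The chosen preimage is unique because `γ` is injective, so every identity for the inner
    -- product is checked after applying `γ`.
    { toFun := fun z' => (hin z z.2 z' z'.2).choose
      map_add' := fun z₁ z₂ => hγ (by
        rw [map_add, (hin z z.2 _ (z₁ + z₂).2).choose_spec, (hin z z.2 _ z₁.2).choose_spec,
          (hin z z.2 _ z₂.2).choose_spec]
        exact mul_add _ _ _)
      map_smul' := fun c z₁ => hγ (by
        rw [map_smul, (hin z z.2 _ (c • z₁).2).choose_spec, (hin z z.2 _ z₁.2).choose_spec]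
        exact mul_smul_comm _ _ _) }
  rsmul := LinearMap.mk₂ ℂ (fun c z => ⟨z.1 * γ c, hr c z z.2⟩)
    (fun _ _ _ => Subtype.ext (by simp [mul_add]))
    (fun _ _ _ => Subtype.ext (by simp [mul_smul_comm]))
    (fun _ _ _ => Subtype.ext (add_mul _ _ _)) (fun _ _ _ => Subtype.ext (smul_mul_assoc _ _ _))
  lsmul :=
    { toFun := fun a => LinearMap.mkContinuous
        { toFun := fun z => ⟨α a * z.1, hl a z z.2⟩
          map_add' := fun y z => Subtype.ext (mul_add _ _ _)
          map_smul' := fun c y => Subtype.ext (mul_smul_comm _ _ _) } ‖α a‖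
        (fun z => norm_mul_le (α a) z.1)
      map_add' := fun _ _ => ContinuousLinearMap.ext fun _ => Subtype.ext
        ((congrArg (· * _) (map_add α _ _)).trans (add_mul _ _ _))
      map_smul' := fun _ _ => ContinuousLinearMap.ext fun _ => Subtype.ext
        ((congrArg (· * _) (map_smul α _ _)).trans (smul_mul_assoc _ _ _)) }
  star_inner z z' := hγ (by
    change γ (star (hin z z.2 z' z'.2).choose) = γ (hin z' z'.2 z z.2).choose
    rw [map_star, (hin z z.2 z' z'.2).choose_spec, (hin z' z'.2 z z.2).choose_spec, star_mul,
      star_star])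
  inner_self_nonneg z := by
    obtain ⟨c, hc⟩ := exists_map_star_mul_self γ hγ (hin z z.2 z z.2).choose_spec
    exact ⟨c, hγ ((hin z z.2 z z.2).choose_spec.trans hc.symm)⟩
  norm_sq z := by
    change ‖z.1‖ ^ 2 = ‖(hin z z.2 z z.2).choose‖
    rw [← NonUnitalStarAlgHom.norm_map γ hγ, (hin z z.2 z z.2).choose_spec,
      CStarRing.norm_star_mul_self, sq]
  inner_rsmul z z' c := hγ
    ((Exists.choose_spec (p := fun b => γ b = star z.1 * (z'.1 * γ c)) _).trans
      ((map_mul γ _ c).trans ((congrArg (· * γ c) (hin z z.2 z' z'.2).choose_spec).trans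
        (mul_assoc _ _ _))).symm)
  rsmul_mul b c z := Subtype.ext (by
    change z.1 * γ (b * c) = z.1 * γ b * γ c
    rw [map_mul, mul_assoc])
  lsmul_mul a c z := Subtype.ext (by
    change α (a * c) * z.1 = α a * (α c * z.1)
    rw [map_mul, mul_assoc])
  inner_lsmul a z z' := hγ
    ((Exists.choose_spec (p := fun b => γ b = star (α a * z.1) * z'.1) _).trans (.trans
      (by rw [star_mul, map_star, mul_assoc])
      (Exists.choose_spec (p := fun b => γ b = star z.1 * (α (star a) * z'.1)) _).symm))
  nondegenerate := by
    rw [eq_top_iff]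
    rintro ⟨z, hz⟩ -
    set N := (Submodule.span ℂ {y : Z | ∃ (a : A) (z : Z),
      y = ⟨α a * z.1, hl a z z.2⟩}).topologicalClosure with hN
    have hNc : IsClosed (N.map Z.subtype : Set 𝔅) :=
      hZ.isClosedEmbedding_subtypeVal.isClosedMap _ (Submodule.isClosed_topologicalClosure _)
    have hle : Z ≤ N.map Z.subtype := by
      refine hnd.trans (Submodule.topologicalClosure_minimal _ (Submodule.span_le.2 ?_) hNc)
      rintro _ ⟨a, z, hz, rfl⟩
      exact ⟨⟨α a * z, hl a z hz⟩, Submodule.le_topologicalClosure _ (Submodule.subset_span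
        ⟨a, ⟨z, hz⟩, rfl⟩), rfl⟩
    obtain ⟨y, hy, hyz⟩ := hle hz
    have : y = ⟨z, hz⟩ := Subtype.ext hyz
    rw [← this]
    exact hy

/-- A representation of the correspondence `X` in a C*-algebra, with injective homomorphisms of the
coefficient algebras. -/
structure IsRepresentation (X : CStarCorrespondence A B) (α : A →⋆ₙₐ[ℂ] 𝔅) (β : B →⋆ₙₐ[ℂ] 𝔅)
    (f : X.carrier →ₗ[ℂ] 𝔅) : Prop where
  left_injective : Function.Injective α
  right_injective : Function.Injective β
  map_inner : ∀ ξ η, β (X.inner ξ η) = star (f ξ) * f η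
  map_lsmul : ∀ a ξ, f (X.lsmul a ξ) = α a * f ξ
  map_rsmul : ∀ b ξ, f (X.rsmul b ξ) = f ξ * β b

theorem IsRepresentation.norm_map {X : CStarCorrespondence A B} {α : A →⋆ₙₐ[ℂ] 𝔅}
    {β : B →⋆ₙₐ[ℂ] 𝔅} {f : X.carrier →ₗ[ℂ] 𝔅} (hf : X.IsRepresentation α β f) (ξ : X.carrier) :
    ‖f ξ‖ = ‖ξ‖ := by
  have := X.norm_sq ξ
  rw [← NonUnitalStarAlgHom.norm_map β hf.right_injective, hf.map_inner,
    CStarRing.norm_star_mul_self, ← sq] at this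
  exact ((sq_eq_sq₀ (norm_nonneg _) (norm_nonneg _)).1 this).symm

/-- The closed linear span of the products of elements in the ranges of `f` and `g`. -/
def productSpace {X Y : Type*} [AddCommGroup X] [Module ℂ X] [AddCommGroup Y] [Module ℂ Y]
    (f : X →ₗ[ℂ] 𝔅) (g : Y →ₗ[ℂ] 𝔅) : Submodule ℂ 𝔅 :=
  (Submodule.span ℂ {z | ∃ x y, z = f x * g y}).topologicalClosure

theorem mul_mem_productSpace {X Y : Type*} [AddCommGroup X] [Module ℂ X] [AddCommGroup Y]
    [Module ℂ Y] (f : X →ₗ[ℂ] 𝔅) (g : Y →ₗ[ℂ] 𝔅) (x : X) (y : Y) :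
    f x * g y ∈ productSpace f g :=
  Submodule.le_topologicalClosure _ (Submodule.subset_span ⟨x, y, rfl⟩)

section

variable {X : CStarCorrespondence A B} {Y : CStarCorrespondence B C} {α : A →⋆ₙₐ[ℂ] 𝔅}
  {β : B →⋆ₙₐ[ℂ] 𝔅} {γ : C →⋆ₙₐ[ℂ] 𝔅} {f : X.carrier →ₗ[ℂ] 𝔅} {g : Y.carrier →ₗ[ℂ] 𝔅}

/-- The closed span of the products of the elements of two represented correspondences, as a
correspondence. -/
def productCorrespondence (hf : X.IsRepresentation α β f) (hg : Y.IsRepresentation β γ g)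
    (Z : Submodule ℂ 𝔅) (hZ : Z = productSpace f g) : CStarCorrespondence A C :=
  ofSubspace Z (hZ ▸ Submodule.isClosed_topologicalClosure _) α γ hg.right_injective
    (by
      subst hZ
      have hcl : IsClosed (LinearMap.range (γ : C →ₗ[ℂ] 𝔅) : Set 𝔅) := by
        rw [LinearMap.coe_range]
        exact isClosed_range_of_norm_eq γ (NonUnitalStarAlgHom.norm_map γ hg.right_injective)
      intro z hz z' hz'
      refine map_mem_of_mem_closure_span (f := fun z' => star z * z')
        (continuous_const.mul continuous_id) (mul_add _) (fun c y => mul_smul_comm c _ y) hcl ?_ hz'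
      rintro _ ⟨x', y', rfl⟩
      -- The product is only conjugate-linear in `z`, so the density argument in `z` is applied to
      -- its adjoint. On generators, g(y')^* f(x')^* f(x) g(y) is the image of ⟨y', ⟨x', x⟩ y⟩.
      have key : star (f x' * g y') * z ∈ LinearMap.range (γ : C →ₗ[ℂ] 𝔅) := by
        refine map_mem_of_mem_closure_span (f := fun z => star (f x' * g y') * z)
          (continuous_const.mul continuous_id) (mul_add _) (fun c y => mul_smul_comm c _ y) hcl ?_
          hz
        rintro _ ⟨x, y, rfl⟩
        refine ⟨Y.inner y' (Y.lsmul (X.inner x' x) y), ?_⟩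
        change γ _ = _
        rw [hg.map_inner, hg.map_lsmul, hf.map_inner, star_mul]
        simp only [mul_assoc]
      obtain ⟨c, hc⟩ := key
      refine ⟨star c, ?_⟩
      change γ c = _ at hc
      change γ (star c) = _
      rw [map_star, hc, star_mul, star_star])
    (by
      subst hZ
      intro a z hz
      refine map_mem_of_mem_closure_span (f := fun z => α a * z)
        (continuous_const.mul continuous_id) (mul_add _) (fun c y => mul_smul_comm c _ y)
        (Submodule.isClosed_topologicalClosure _) ?_ hz
      rintro _ ⟨x, y, rfl⟩
      rw [← mul_assoc, ← hf.map_lsmul]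
      exact mul_mem_productSpace f g _ _)
    (by
      subst hZ
      intro c z hz
      refine map_mem_of_mem_closure_span (f := fun z => z * γ c)
        (continuous_id.mul continuous_const) (fun _ _ => add_mul _ _ _)
        (fun c y => smul_mul_assoc c y _) (Submodule.isClosed_topologicalClosure _) ?_ hz
      rintro _ ⟨x, y, rfl⟩
      rw [mul_assoc, ← hg.map_rsmul]
      exact mul_mem_productSpace f g _ _)
    (by
      subst hZ
      refine Submodule.topologicalClosure_minimal _ (Submodule.span_le.2 ?_)
        (Submodule.isClosed_topologicalClosure _)
      rintro _ ⟨x, y, rfl⟩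
      have hx : x ∈ (Submodule.span ℂ {y : X.carrier | ∃ a x,
          y = X.lsmul a x}).topologicalClosure := by
        rw [X.nondegenerate]; trivial
      refine map_mem_of_mem_closure_span (f := fun x => f x * g y)
        ((AddMonoidHomClass.isometry_of_norm f hf.norm_map).continuous.mul continuous_const)
        (fun _ _ => by rw [map_add, add_mul]) (fun c x => by rw [map_smul, smul_mul_assoc])
        (Submodule.isClosed_topologicalClosure _) ?_ hx
      rintro _ ⟨a, x, rfl⟩
      rw [hf.map_lsmul, mul_assoc]
      exact Submodule.le_topologicalClosure _ (Submodule.subset_span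
        ⟨a, _, mul_mem_productSpace f g x y, rfl⟩))

/-- The interior tensor product of two correspondences that are represented in the same
C*-algebra. -/
def InteriorTensor.ofRepresentation (hf : X.IsRepresentation α β f)
    (hg : Y.IsRepresentation β γ g) (Z : Submodule ℂ 𝔅) (hZ : Z = productSpace f g) :
    InteriorTensor X Y where
  prod := productCorrespondence hf hg Z hZ
  tmul := LinearMap.mk₂ ℂ (fun x y => (⟨f x * g y, hZ ▸ mul_mem_productSpace f g x y⟩ : Z))
    (fun _ _ _ => Subtype.ext ((congrArg (· * _) (map_add f _ _)).trans (add_mul _ _ _)))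
    (fun _ _ _ => Subtype.ext ((congrArg (· * _) (map_smul f _ _)).trans (smul_mul_assoc _ _ _)))
    (fun _ _ _ => Subtype.ext ((congrArg (_ * ·) (map_add g _ _)).trans (mul_add _ _ _)))
    (fun _ _ _ => Subtype.ext ((congrArg (_ * ·) (map_smul g _ _)).trans (mul_smul_comm _ _ _)))
  inner_tmul x y x' y' := hg.right_injective (by
    refine (Exists.choose_spec (p := fun c => γ c = star (f x * g y) * (f x' * g y')) _).trans ?_
    rw [hg.map_inner, hg.map_lsmul, hf.map_inner, star_mul]
    simp only [mul_assoc])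
  lsmul_tmul a x y := Subtype.ext (by
    change α a * (f x * g y) = f (X.lsmul a x) * g y
    rw [hf.map_lsmul, mul_assoc])
  rsmul_tmul c x y := Subtype.ext (by
    change f x * g y * γ c = f x * g (Y.rsmul c y)
    rw [hg.map_rsmul, mul_assoc])
  dense := by
    rw [eq_top_iff]
    rintro ⟨z, hz⟩ -
    set N := (Submodule.span ℂ {z : Z | ∃ x y,
      z = ⟨f x * g y, hZ ▸ mul_mem_productSpace f g x y⟩}).topologicalClosure with hN
    have hZc : IsClosed (Z : Set 𝔅) := hZ ▸ Submodule.isClosed_topologicalClosure _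
    have hNc : IsClosed (N.map Z.subtype : Set 𝔅) :=
      hZc.isClosedEmbedding_subtypeVal.isClosedMap _ (Submodule.isClosed_topologicalClosure _)
    have hle : Z ≤ N.map Z.subtype := by
      refine hZ.le.trans (Submodule.topologicalClosure_minimal _ (Submodule.span_le.2 ?_) hNc)
      rintro _ ⟨x, y, rfl⟩
      exact ⟨⟨f x * g y, hZ ▸ mul_mem_productSpace f g x y⟩, Submodule.le_topologicalClosure _
        (Submodule.subset_span ⟨x, y, rfl⟩), rfl⟩
    obtain ⟨y, hy, hyz⟩ := hle hz
    have : y = ⟨z, hz⟩ := Subtype.ext hyz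
    rw [← this]
    exact hy

end

/-- Correspondences that are represented in the same C*-algebra satisfy `X ⊗ M ≅ M ⊗ Y` if the
products of their elements in both orders span the same space. -/
theorem exists_unitarilyIsomorphic_of_productSpace_eq {X : CStarCorrespondence A A}
    {Y : CStarCorrespondence B B} {M : CStarCorrespondence A B} {α : A →⋆ₙₐ[ℂ] 𝔅}
    {β : B →⋆ₙₐ[ℂ] 𝔅} {f : X.carrier →ₗ[ℂ] 𝔅} {g : Y.carrier →ₗ[ℂ] 𝔅} {h : M.carrier →ₗ[ℂ] 𝔅}
    (hf : X.IsRepresentation α α f) (hg : Y.IsRepresentation β β g)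
    (hh : M.IsRepresentation α β h) (heq : productSpace f h = productSpace h g) :
    ∃ (XM : InteriorTensor X M) (MY : InteriorTensor M Y),
      UnitarilyIsomorphic XM.prod MY.prod :=
  -- Both tensor products are realized on literally the same subspace `productSpace f h`, the second
  -- through `heq`. The unitary is therefore the identity, and the actions agree definitionally.
  ⟨InteriorTensor.ofRepresentation hf hh _ rfl, InteriorTensor.ofRepresentation hh hg _ heq,
    LinearIsometryEquiv.refl ℂ _, fun _ _ _ => ⟨rfl, rfl⟩⟩

end Concrete

theorem IsImprimitivity.changeCoeff {A B A' B' : Type v} [NonUnitalCStarAlgebra A]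
    [NonUnitalCStarAlgebra B] [NonUnitalCStarAlgebra A'] [NonUnitalCStarAlgebra B']
    {X : CStarCorrespondence A B} (hX : X.IsImprimitivity) (α : A ≃⋆ₐ[ℂ] A') (β : B ≃⋆ₐ[ℂ] B') :
    (X.changeCoeff α β).IsImprimitivity := by
  obtain ⟨h1, h2, h3⟩ := hX
  refine ⟨?_, ?_, ?_⟩
  · unfold IsFull
    rw [eq_top_iff]
    rintro b -
    have hb : β.symm b ∈ (Submodule.span ℂ {b : B | ∃ x y, b = X.inner x y}).topologicalClosure := by
      rw [h1]; trivial
    have := map_mem_of_mem_closure_span (StarAlgEquiv.isometry β).continuous (map_add β)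
      (map_smul β) (Submodule.isClosed_topologicalClosure (Submodule.span ℂ {b : B' | ∃ x y,
        b = (X.changeCoeff α β).inner x y})) ?_ hb
    · simpa using this
    · rintro _ ⟨x, y, rfl⟩
      exact Submodule.le_topologicalClosure _ (Submodule.subset_span ⟨x, y, rfl⟩)
  · exact h2.comp α.symm.injective
  -- In a rank one operator the inner product passes through `β` and back through `β.symm`.
  · have hc : (X.changeCoeff α β).compacts = X.compacts := by
      unfold compacts
      congr 2
      ext T
      refine exists_congr fun ξ => exists_congr fun η => forall_congr' fun ζ => ?_
      change T ζ = X.rsmul (β.symm (β (X.inner η ζ))) ξ ↔ _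
      rw [β.symm_apply_apply]
      rfl
    rw [hc]
    refine Eq.trans ?_ h3
    exact α.symm.surjective.range_comp X.lsmul

end CStarCorrespondence

/-! ### Norms of multiplication operators -/

/-- Let `a` be a self-adjoint element in the closed span of the `x y^*` with `x, y ∈ X`, where `X`
is invariant under multiplication by `a` on the left. The norm of `a` is that of the
multiplication operator on `X`. -/
theorem IsSelfAdjoint.norm_le_of_forall_norm_mul_le {𝔄 : Type*} [NonUnitalCStarAlgebra 𝔄]
    {X : Set 𝔄} {a : 𝔄} (hsa : IsSelfAdjoint a)
    (ha : a ∈ (Submodule.span ℂ {z : 𝔄 | ∃ x ∈ X, ∃ y ∈ X, z = x * star y}).topologicalClosure)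
    (hX : ∀ x ∈ X, a * x ∈ X) {C : ℝ} (hC : 0 ≤ C) (h : ∀ x ∈ X, ‖a * x‖ ≤ C * ‖x‖) :
    ‖a‖ ≤ C := by
  by_contra! hlt
  -- Without a unit, powers of `a` are taken as powers of left multiplication: `(f ^ n) b` stands
  -- for a^n b, and `(f ^ n) a` for a^(n+1).
  set f : Module.End ℂ 𝔄 := LinearMap.mulLeft ℂ a with hf
  have hsucc : ∀ n b, (f ^ (n + 1)) b = a * (f ^ n) b := fun n b => by
    rw [pow_succ']; rfl
  have hassoc : ∀ n b c, (f ^ n) (b * c) = (f ^ n) b * c := by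
    intro n
    induction n with
    | zero => exact fun _ _ => rfl
    | succ n ih => intro b c; rw [hsucc, hsucc, ih, mul_assoc]
  have hmul : ∀ n k, (f ^ n) a * (f ^ k) a = (f ^ (n + k + 1)) a := by
    intro n k
    rw [← hassoc, ← hsucc, ← Module.End.mul_apply, ← pow_add]
    rfl
  have hstar : ∀ n, star ((f ^ n) a) = (f ^ n) a := by
    intro n
    induction n with
    | zero => exact hsa
    | succ n ih =>
      rw [hsucc, star_mul, ih, hsa.star_eq]
      have h1 := hmul n 0
      have h2 := hsucc n a
      simp only [pow_zero, Module.End.one_apply, Nat.add_zero] at h1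
      rw [h1, h2]
  -- Repeated squaring in the C*-identity; the exponent is 2^j - 1 because one factor `a` is the
  -- argument.
  have hnorm : ∀ j, ‖(f ^ (2 ^ j - 1)) a‖ = ‖a‖ ^ (2 ^ j) := by
    intro j
    induction j with
    | zero => simp
    | succ j ih =>
      have hj : 2 ^ (j + 1) - 1 = (2 ^ j - 1) + (2 ^ j - 1) + 1 := by
        have := Nat.one_le_two_pow (n := j)
        rw [pow_succ]; omega
      rw [hj, ← hmul]
      nth_rewrite 1 [← hstar]
      rw [CStarRing.norm_star_mul_self, ih, ← pow_add]
      congr 1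
      rw [pow_succ]; omega
  have hX' : ∀ n, ∀ x ∈ X, (f ^ n) x ∈ X ∧ ‖(f ^ n) x‖ ≤ C ^ n * ‖x‖ := by
    intro n x hx
    induction n with
    | zero => exact ⟨hx, by simp⟩
    | succ n ih =>
      rw [hsucc]
      refine ⟨hX _ ih.1, (h _ ih.1).trans ?_⟩
      calc C * ‖(f ^ n) x‖ ≤ C * (C ^ n * ‖x‖) := mul_le_mul_of_nonneg_left ih.2 hC
        _ = C ^ (n + 1) * ‖x‖ := by ring
  have hbound : ∀ b, ∀ n, ‖(f ^ n) b‖ ≤ ‖a‖ ^ n * ‖b‖ := by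
    intro b n
    induction n with
    | zero => simp
    | succ n ih =>
      rw [hsucc]
      calc ‖a * (f ^ n) b‖ ≤ ‖a‖ * ‖(f ^ n) b‖ := norm_mul_le _ _
        _ ≤ ‖a‖ * (‖a‖ ^ n * ‖b‖) := mul_le_mul_of_nonneg_left ih (norm_nonneg _)
        _ = ‖a‖ ^ (n + 1) * ‖b‖ := by ring
  -- On a finite sum of x y^* the powers of `a` grow at most like C^n, because they act on the
  -- factors x.
  have hspan : ∀ k ∈ Submodule.span ℂ {z : 𝔄 | ∃ x ∈ X, ∃ y ∈ X, z = x * star y},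
      ∃ D, ∀ n, ‖(f ^ n) k‖ ≤ C ^ n * D := by
    intro k hk
    induction hk using Submodule.span_induction with
    | mem k hk =>
      obtain ⟨x, hx, y, -, rfl⟩ := hk
      refine ⟨‖x‖ * ‖star y‖, fun n => ?_⟩
      rw [hassoc, ← mul_assoc]
      exact (norm_mul_le _ _).trans (mul_le_mul_of_nonneg_right (hX' n x hx).2 (norm_nonneg _))
    | zero => exact ⟨0, by simp⟩
    | add x y _ _ hx hy =>
      obtain ⟨D, hD⟩ := hx
      obtain ⟨D', hD'⟩ := hy
      refine ⟨D + D', fun n => ?_⟩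
      rw [map_add, mul_add]
      exact (norm_add_le _ _).trans (add_le_add (hD n) (hD' n))
    | smul c x _ hx =>
      obtain ⟨D, hD⟩ := hx
      refine ⟨‖c‖ * D, fun n => ?_⟩
      rw [map_smul, norm_smul, mul_left_comm]
      exact mul_le_mul_of_nonneg_left (hD n) (norm_nonneg _)
  have hpos : 0 < ‖a‖ := hC.trans_lt hlt
  -- The error a - k contributes at most half of ‖a‖^(n+1). The other half must come from k, where
  -- growth is only C^n with C < ‖a‖; this fails for large n.
  obtain ⟨k, hk, hak⟩ := Metric.mem_closure_iff.1 ha (‖a‖ / 2) (by positivity)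
  rw [dist_eq_norm] at hak
  obtain ⟨D, hD⟩ := hspan k hk
  have hmain : ∀ j, ‖a‖ / 2 ≤ (C / ‖a‖) ^ (2 ^ j - 1) * D := by
    intro j
    set n := 2 ^ j - 1 with hn
    have hj : 2 ^ j = n + 1 := by
      have := Nat.one_le_two_pow (n := j)
      omega
    have h1 : ‖a‖ ^ (n + 1) ≤ C ^ n * D + ‖a‖ ^ n * (‖a‖ / 2) := by
      rw [← hj, ← hnorm j, ← hn]
      calc ‖(f ^ n) a‖ = ‖(f ^ n) k + (f ^ n) (a - k)‖ := by rw [← map_add]; congr 2; abel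
        _ ≤ ‖(f ^ n) k‖ + ‖(f ^ n) (a - k)‖ := norm_add_le _ _
        _ ≤ C ^ n * D + ‖a‖ ^ n * ‖a - k‖ := add_le_add (hD n) (hbound _ n)
        _ ≤ _ := by gcongr
    have h2 : ‖a‖ ^ n * (‖a‖ / 2) ≤ C ^ n * D := by
      rw [pow_succ] at h1
      linarith
    rw [div_pow, div_mul_eq_mul_div, le_div_iff₀ (by positivity)]
    linarith
  have hlim : Filter.Tendsto (fun n : ℕ => (C / ‖a‖) ^ (2 ^ n - 1) * D) Filter.atTop
      (nhds (0 * D)) := by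
    refine Filter.Tendsto.mul_const _ ?_
    refine (tendsto_pow_atTop_nhds_zero_of_lt_one (by positivity)
      ((div_lt_one hpos).2 hlt)).comp (Filter.tendsto_atTop_mono (fun n => ?_) Filter.tendsto_id)
    have := Nat.lt_two_pow_self (n := n)
    simp only [id]
    omega
  have := ge_of_tendsto' hlim hmain
  linarith

/-- The self-adjoint case for a^* a, with constant ‖a‖ C, gives ‖a‖² ≤ ‖a‖ C. -/
theorem norm_le_of_forall_norm_mul_le {𝔄 : Type*} [NonUnitalCStarAlgebra 𝔄] {X : Set 𝔄} {a : 𝔄}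
    (ha : star a * a ∈
      (Submodule.span ℂ {z : 𝔄 | ∃ x ∈ X, ∃ y ∈ X, z = x * star y}).topologicalClosure)
    (hX : ∀ x ∈ X, star a * a * x ∈ X) {C : ℝ} (hC : 0 ≤ C) (h : ∀ x ∈ X, ‖a * x‖ ≤ C * ‖x‖) :
    ‖a‖ ≤ C := by
  have h1 : ‖star a * a‖ ≤ ‖a‖ * C := by
    refine IsSelfAdjoint.norm_le_of_forall_norm_mul_le (.star_mul_self a) ha hX (by positivity)
      fun x hx => ?_
    rw [mul_assoc, mul_assoc]
    refine (norm_mul_le _ _).trans ?_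
    rw [norm_star]
    exact mul_le_mul_of_nonneg_left (h x hx) (norm_nonneg _)
  rw [CStarRing.norm_star_mul_self] at h1
  rcases (norm_nonneg a).eq_or_lt with h0 | h0
  · rw [← h0]; exact hC
  · exact le_of_mul_le_mul_left h1 h0

/-- If a set spans a dense subspace of a closed subspace `Z`, it does so in the topology of `Z`. -/
theorem topologicalClosure_span_preimage_eq_top {X : Type*} [NormedAddCommGroup X]
    [NormedSpace ℂ X] {Z : Submodule ℂ X} (hZ : IsClosed (Z : Set X)) {s : Set X} (hs : s ⊆ Z)
    (h : Z ≤ (Submodule.span ℂ s).topologicalClosure) :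
    (Submodule.span ℂ {z : Z | z.1 ∈ s}).topologicalClosure = ⊤ := by
  rw [eq_top_iff]
  rintro ⟨z, hz⟩ -
  set N := (Submodule.span ℂ {z : Z | z.1 ∈ s}).topologicalClosure with hN
  have hNc : IsClosed (N.map Z.subtype : Set X) :=
    hZ.isClosedEmbedding_subtypeVal.isClosedMap _ (Submodule.isClosed_topologicalClosure _)
  have hle : Z ≤ N.map Z.subtype := by
    refine h.trans (Submodule.topologicalClosure_minimal _ (Submodule.span_le.2 ?_) hNc)
    intro y hy
    exact ⟨⟨y, hs hy⟩, Submodule.le_topologicalClosure _ (Submodule.subset_span hy), rfl⟩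
  obtain ⟨y, hy, hyz⟩ := hle hz
  have : y = ⟨z, hz⟩ := Subtype.ext hyz
  rw [← this]
  exact hy

namespace GraphCStar

variable {Ω : Type u} {E : ArrowGraph.{u, 0} Ω}

theorem isClosed_spectral (d : ℤ) (K L : Set Ω) :
    IsClosed (spectral E d K L : Set (GraphCStar E)) :=
  Submodule.isClosed_topologicalClosure _

/-! ### The spectral subspace of degree one -/

theorem S_mem_spectral {K L : Set Ω} {v w : Ω} (e : E v w) (hv : v ∈ K) (hw : w ∈ L) :
    S E e ∈ spectral E 1 K L := by
  have h := isCKFamily E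
  have := pathOp_mul_mem_spectral (d := 1) (GPath.cons e (GPath.nil w)) (GPath.nil w) (by simp)
    hv hw
  rw [h.pathOp_single] at this
  simp only [pathOp] at this
  rwa [h.star_P, h.S_mul_P] at this

theorem mul_mem_spectral_one (hE : RowFinite E) {K L : Set Ω} {a b : GraphCStar E}
    (ha : a ∈ spectral E 0 K K) (hb : b ∈ spectral E 1 K L) : a * b ∈ spectral E 1 K L := by
  simpa using spectral_mul_mem hE ha hb

theorem spectral_one_mul_mem (hE : RowFinite E) {K L : Set Ω} {a b : GraphCStar E}
    (ha : a ∈ spectral E 1 K L) (hb : b ∈ spectral E 0 L L) : a * b ∈ spectral E 1 K L := by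
  simpa using spectral_mul_mem hE ha hb

/-- In a generator S_μ S_ν^* of degree one, μ has a first edge. Removing it leaves an element of
degree 0 whose two paths start in `L`. -/
theorem spectral_one_le {K L : Set Ω} (hKL : ∀ v ∈ K, ∀ w, E v w → w ∈ L) :
    spectral E 1 K L ≤ (Submodule.span ℂ {a : GraphCStar E | ∃ (v w : Ω) (e : E v w)
      (b : GraphCStar E), v ∈ K ∧ b ∈ spectral E 0 L L ∧ a = S E e * b}).topologicalClosure := by
  refine Submodule.topologicalClosure_mono (Submodule.span_mono ?_)
  rintro _ ⟨n, k, v, v', w, μ, ν, hnk, hv, hv', rfl⟩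
  cases μ with
  | nil => exfalso; omega
  | @cons _ z _ n e p =>
    exact ⟨v, z, e, _, hv, pathOp_mul_mem_spectral p ν (d := 0) (by push_cast at hnk; omega)
      (hKL v hv z e) hv', by simp only [pathOp, mul_assoc]⟩

/-- After lengthening the paths by one edge, write ν = e p. Then S_μ S_ν^* = (S_μ S_p^*) (S_ν
S_p^*)^*, where both factors have degree one and p starts in `L`. -/
theorem core_le_closure_span_mul_star (hE : RowFinite E) (hs : ∀ v, Nonempty (Σ w : Ω, E v w))
    {K L : Set Ω} (hKL : ∀ v ∈ K, ∀ w, E v w → w ∈ L) :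
    spectral E 0 K K ≤ (Submodule.span ℂ {a : GraphCStar E | ∃ x ∈ spectral E 1 K L,
      ∃ y ∈ spectral E 1 K L, a = x * star y}).topologicalClosure := by
  have h := isCKFamily E
  refine Submodule.topologicalClosure_mono (Submodule.span_le.2 ?_)
  rintro _ ⟨n, k, v, v', w, μ, ν, hnk, hv, hv', rfl⟩
  obtain rfl : n = k := by omega
  have hle : matrixSpan (pathsFrom E (n + 1) K) ≤ Submodule.span ℂ {a : GraphCStar E |
      ∃ x ∈ spectral E 1 K L, ∃ y ∈ spectral E 1 K L, a = x * star y} := by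
    refine Submodule.span_mono ?_
    rintro _ ⟨⟨v, w, μ⟩, hv, ⟨v', w', ν⟩, hv', rfl, rfl⟩
    cases ν with
    | @cons _ z _ _ e p =>
      have hz := hKL _ hv' z e
      refine ⟨_, pathOp_mul_mem_spectral μ p (by simp) hv hz, _,
        pathOp_mul_mem_spectral (GPath.cons e p) p (by simp) hv' hz, ?_⟩
      rw [star_mul, star_star, mul_assoc, ← mul_assoc (star (pathOp _ _ p)),
        h.star_pathOp_mul_self hE, ← mul_assoc, h.pathOp_mul_P]
  exact hle (matrixSpan_le_succ hE hs n K (pathOp_mul_star_mem_matrixSpan μ ν hv hv'))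

/-- If e is an edge from `K` to the source of μ, then b = S_μ S_ν^* equals S_e^* (S_e b). -/
theorem core_le_closure_span_star_mul (hE : RowFinite E) {K L : Set Ω}
    (hin : ∀ w ∈ L, ∃ v ∈ K, Nonempty (E v w)) :
    spectral E 0 L L ≤ (Submodule.span ℂ {a : GraphCStar E | ∃ x ∈ spectral E 1 K L,
      ∃ y ∈ spectral E 1 K L, a = star x * y}).topologicalClosure := by
  have h := isCKFamily E
  refine Submodule.topologicalClosure_mono (Submodule.span_mono ?_)
  rintro _ ⟨n, k, v, v', w, μ, ν, hnk, hv, hv', rfl⟩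
  obtain ⟨u, hu, ⟨e⟩⟩ := hin v hv
  have he := S_mem_spectral e hu hv
  refine ⟨_, he, _, spectral_one_mul_mem hE he (pathOp_mul_mem_spectral μ ν hnk hv hv'), ?_⟩
  rw [← mul_assoc, h.star_mul_self, ← mul_assoc, h.P_mul_pathOp hE]

/-- The corner of degree one between two sets of vertices is an imprimitivity bimodule, when every
edge from `K` leads to `L` and every vertex of `L` receives an edge from `K`. -/
theorem dilation_isImprimitivity (hE : RowFinite E) (hs : ∀ v, Nonempty (Σ w : Ω, E v w))
    {K L : Set Ω} (hKL : ∀ v ∈ K, ∀ w, E v w → w ∈ L)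
    (hin : ∀ w ∈ L, ∃ v ∈ K, Nonempty (E v w)) : (dilation E hE K L).IsImprimitivity := by
  have hnorm_le : ∀ a : core E hE K, ‖(dilation E hE K L).lsmul a‖ ≤ ‖a‖ := fun a =>
    ContinuousLinearMap.opNorm_le_bound _ (norm_nonneg _) fun x => norm_mul_le a.1 x.1
  have hnorm : ∀ a : core E hE K, ‖(dilation E hE K L).lsmul a‖ = ‖a‖ := by
    intro a
    -- The norm of `a` is detected on X because a^* a lies in the closed span of X X^*. Injectivity
    -- and closed range of the left action both follow from this isometry.
    refine le_antisymm (hnorm_le a) ?_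
    have haa : star a.1 * a.1 ∈ spectral E 0 K K := (star a * a).2
    refine norm_le_of_forall_norm_mul_le (X := (spectral E 1 K L : Set (GraphCStar E)))
      (core_le_closure_span_mul_star hE hs hKL haa)
      (fun x hx => mul_mem_spectral_one hE haa hx) (norm_nonneg _) fun x hx => ?_
    exact ((dilation E hE K L).lsmul a).le_opNorm ⟨x, hx⟩
  refine ⟨?_, ?_, ?_⟩
  · have := topologicalClosure_span_preimage_eq_top (isClosed_spectral 0 L L) ?_
      (core_le_closure_span_star_mul hE hin)
    · unfold CStarCorrespondence.IsFull
      rw [eq_top_iff] at this ⊢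
      intro b hb
      refine closure_mono (Submodule.span_mono ?_) (this (x := b) hb)
      rintro c ⟨x, hx, y, hy, hc⟩
      exact ⟨⟨x, hx⟩, ⟨y, hy⟩, Subtype.ext hc⟩
    · rintro _ ⟨x, hx, y, hy, rfl⟩
      simpa using spectral_mul_mem hE (spectral_star_mem hx) hy
  · refine (injective_iff_map_eq_zero _).2 fun a ha => ?_
    rw [← norm_eq_zero, ← hnorm, ha, norm_zero]
  · have hrank : ∀ x (hx : x ∈ spectral E 1 K L) y (hy : y ∈ spectral E 1 K L),
        x * star y ∈ spectral E 0 K K := fun x hx y hy => by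
      simpa using spectral_mul_mem hE hx (spectral_star_mem hy)
    apply Set.Subset.antisymm
    · rintro _ ⟨a, rfl⟩
      have hd := topologicalClosure_span_preimage_eq_top (isClosed_spectral 0 K K) ?_
        (core_le_closure_span_mul_star hE hs hKL)
      · have ha : a ∈ (Submodule.span ℂ {b : core E hE K | ∃ x ∈ spectral E 1 K L,
            ∃ y ∈ spectral E 1 K L, b.1 = x * star y}).topologicalClosure := by
          rw [eq_top_iff] at hd
          exact hd (x := a) trivial
        refine map_mem_of_mem_closure_span
          (AddMonoidHomClass.isometry_of_norm (dilation E hE K L).lsmul hnorm).continuous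
          (map_add _) (map_smul _) (Submodule.isClosed_topologicalClosure _) ?_ ha
        -- Multiplication by x y^* is the rank one operator ζ ↦ x ⟨y, ζ⟩, by associativity.
        rintro ⟨_, hb⟩ ⟨x, hx, y, hy, rfl⟩
        exact Submodule.le_topologicalClosure _ (Submodule.subset_span
          ⟨⟨x, hx⟩, ⟨y, hy⟩, fun ζ => Subtype.ext (mul_assoc _ _ _)⟩)
      · rintro _ ⟨x, hx, y, hy, rfl⟩
        exact hrank x hx y hy
    · have hcl : IsClosed (LinearMap.range (dilation E hE K L).lsmul :
          Set ((dilation E hE K L).carrier →L[ℂ] (dilation E hE K L).carrier)) := by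
        rw [LinearMap.coe_range]
        exact isClosed_range_of_norm_eq _ hnorm
      rw [← LinearMap.coe_range]
      refine Submodule.topologicalClosure_minimal _ (Submodule.span_le.2 ?_) hcl
      rintro T ⟨x, y, hT⟩
      refine ⟨⟨x.1 * star y.1, hrank _ x.2 _ y.2⟩, ContinuousLinearMap.ext fun ζ => ?_⟩
      rw [hT]
      exact Subtype.ext (mul_assoc _ _ _)

/-! ### Representations -/

section Representation

variable {𝔅 : Type v} [NonUnitalCStarAlgebra 𝔅]

/-- The restriction of a homomorphism to the core. -/
def restrictCore (hE : RowFinite E) (K : Set Ω) (ρ : GraphCStar E →⋆ₙₐ[ℂ] 𝔅) :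
    core E hE K →⋆ₙₐ[ℂ] 𝔅 :=
  ρ.comp (NonUnitalStarSubalgebraClass.subtype (core E hE K))

theorem restrictCore_injective (hE : RowFinite E) (hs : ∀ v, Nonempty (Σ w : Ω, E v w)) {K : Set Ω}
    {ρ : GraphCStar E →⋆ₙₐ[ℂ] 𝔅} (h0 : ∀ v, ρ (P E v) ≠ 0) :
    Function.Injective (restrictCore hE K ρ) := by
  refine (injective_iff_map_eq_zero _).2 fun a ha => Subtype.ext ?_
  have h1 : ρ a.1 = 0 := ha
  refine norm_eq_zero.1 ?_
  rw [← norm_map_core hE hs ρ h0 a.2, h1, norm_zero]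

end Representation

/-! ### Interchanging the degree one parts of two graphs -/

section Commutation

variable {F : ArrowGraph.{u, 0} Ω} {𝔅 : Type v} [NonUnitalCStarAlgebra 𝔅]
  {ρE : GraphCStar E →⋆ₙₐ[ℂ] 𝔅} {ρF : GraphCStar F →⋆ₙₐ[ℂ] 𝔅}

theorem map_S_mul_map_S_of_ne (hF : RowFinite F) (hP : ∀ v, ρE (P E v) = ρF (P F v))
    {v w w' z : Ω} (e : E v w) (f : F w' z) (hw : w ≠ w') : ρE (S E e) * ρF (S F f) = 0 := by
  rw [← (isCKFamily E).S_mul_P e, ← (isCKFamily F).P_mul_S hF f, map_mul, map_mul, hP, mul_assoc,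
    ← mul_assoc (ρF _), ← map_mul ρF, (isCKFamily F).orthogonal w w' hw]
  simp

/-- If the edges of two graphs can be interchanged, so can the spectral subspaces of degree one. -/
theorem map_mul_map_mem (hE : RowFinite E) (hF : RowFinite F) (hP : ∀ v, ρE (P E v) = ρF (P F v))
    {K L L' M : Set Ω} (hKL : ∀ v ∈ K, ∀ w, E v w → w ∈ L) (hLM : ∀ v ∈ L, ∀ w, F v w → w ∈ M)
    (hKL' : ∀ v ∈ K, ∀ w, F v w → w ∈ L')
    (hEF : ∀ a ∈ spectral E 0 L L, ∃ b ∈ spectral F 0 L L, ρF b = ρE a)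
    (hFE : ∀ b ∈ spectral F 0 M M, ∃ a ∈ spectral E 0 M M, ρE a = ρF b)
    (hcomm : ∀ (v w z : Ω) (e : E v w) (f : F w z), ∃ (w' : Ω) (f' : F v w') (e' : E w' z),
      ρE (S E e) * ρF (S F f) = ρF (S F f') * ρE (S E e'))
    {N : Submodule ℂ 𝔅} (hN : IsClosed (N : Set 𝔅))
    (hmem : ∀ x ∈ spectral F 1 K L', ∀ y ∈ spectral E 1 L' M, ρF x * ρE y ∈ N)
    {x : GraphCStar E} (hx : x ∈ spectral E 1 K L) {y : GraphCStar F}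
    (hy : y ∈ spectral F 1 L M) : ρE x * ρF y ∈ N := by
  refine map_mem_of_mem_closure_span (f := fun x => ρE x * ρF y)
    ((continuous_starHom ρE).mul continuous_const) (fun _ _ => by rw [map_add, add_mul])
    (fun _ _ => by rw [map_smul, smul_mul_assoc]) hN ?_ (spectral_one_le hKL hx)
  rintro _ ⟨v, w, e, a, hv, ha, rfl⟩
  -- In S_e a y the core element `a` is replaced by a core element of `F` with the same image and
  -- absorbed into `y`.
  obtain ⟨b, hb, hba⟩ := hEF a ha
  have hby := mul_mem_spectral_one hF hb hy
  rw [map_mul, mul_assoc, ← hba, ← map_mul]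
  generalize b * y = y' at hby
  refine map_mem_of_mem_closure_span (f := fun y => ρE (S E e) * ρF y)
    (continuous_const.mul (continuous_starHom ρF)) (fun _ _ => by rw [map_add, mul_add])
    (fun _ _ => by rw [map_smul, mul_smul_comm]) hN ?_ (spectral_one_le hLM hby)
  rintro _ ⟨w', z, f, c, hw', hc, rfl⟩
  rw [map_mul, ← mul_assoc]
  -- What remains is S_e S_f c. If the edges compose they are interchanged, and `c`, carried over to
  -- the core of `E`, joins the new edge of `E`. Otherwise the product is zero, since the vertex
  -- projections are shared.
  by_cases hw : w = w'
  · subst hw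
    obtain ⟨u, f', e', hfe⟩ := hcomm v w z e f
    obtain ⟨d, hd, hdc⟩ := hFE c hc
    rw [hfe, ← hdc, mul_assoc, ← map_mul]
    have hu := hKL' v hv u f'
    exact hmem _ (S_mem_spectral f' hv hu) _
      (spectral_one_mul_mem hE (S_mem_spectral e' hu (hLM w hw' z f)) hd)
  · rw [map_S_mul_map_S_of_ne hF hP e f hw, zero_mul]
    exact zero_mem _

end Commutation

theorem dilation_isRepresentation (hE : RowFinite E) (hs : ∀ v, Nonempty (Σ w : Ω, E v w))
    {𝔅 : Type (u + 1)} [NonUnitalCStarAlgebra 𝔅] {ρ : GraphCStar E →⋆ₙₐ[ℂ] 𝔅}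
    (h0 : ∀ v, ρ (P E v) ≠ 0) (K L : Set Ω) :
    (dilation E hE K L).IsRepresentation (restrictCore hE K ρ) (restrictCore hE L ρ)
      ((ρ : GraphCStar E →ₗ[ℂ] 𝔅) ∘ₗ (spectral E 1 K L).subtype) where
  left_injective := restrictCore_injective hE hs h0
  right_injective := restrictCore_injective hE hs h0
  map_inner ξ η := by
    change ρ (star ξ.1 * η.1) = star (ρ ξ.1) * ρ η.1
    rw [map_mul, map_star]
  map_lsmul a ξ := map_mul ρ a.1 ξ.1
  map_rsmul b ξ := map_mul ρ ξ.1 b.1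

end GraphCStar

/-- The same operators represent the correspondence when the isomorphisms are compatible with the
coefficient representations. This lets X(R)_∞, with coefficients moved to the cores of C, be
multiplied with X(A)_∞ and X(B)_∞. -/
theorem CStarCorrespondence.IsRepresentation.changeCoeff {A B A' B' 𝔅 : Type v}
    [NonUnitalCStarAlgebra A] [NonUnitalCStarAlgebra B] [NonUnitalCStarAlgebra A']
    [NonUnitalCStarAlgebra B'] [NonUnitalCStarAlgebra 𝔅] {X : CStarCorrespondence A B}
    {α : A →⋆ₙₐ[ℂ] 𝔅} {β : B →⋆ₙₐ[ℂ] 𝔅} {f : X.carrier →ₗ[ℂ] 𝔅} (hf : X.IsRepresentation α β f)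
    {α' : A' →⋆ₙₐ[ℂ] 𝔅} {β' : B' →⋆ₙₐ[ℂ] 𝔅} (hα' : Function.Injective α')
    (hβ' : Function.Injective β') {φ : A ≃⋆ₐ[ℂ] A'} {χ : B ≃⋆ₐ[ℂ] B'}
    (hφ : ∀ a, α' (φ a) = α a) (hχ : ∀ b, β' (χ b) = β b) :
    (X.changeCoeff φ χ).IsRepresentation α' β' f where
  left_injective := hα'
  right_injective := hβ'
  map_inner ξ η := (hχ _).trans (hf.map_inner ξ η)
  map_lsmul a ξ := by
    refine (hf.map_lsmul (φ.symm a) ξ).trans ?_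
    rw [← hφ, φ.apply_symm_apply]
    rfl
  map_rsmul b ξ := by
    refine (hf.map_rsmul (χ.symm b) ξ).trans ?_
    rw [← hχ, χ.apply_symm_apply]
    rfl

/-! ### The graphs of `C` and `D` -/

section BlockGraphs

variable {V W : Type u} {A : Matrix V V ℕ} {B : Matrix W W ℕ} {R : Matrix V W ℕ} {S : Matrix W V ℕ}

theorem graphC_mem_partV : ∀ v ∈ partV V W, ∀ w, graphC A B v w → w ∈ partV V W := by
  rintro _ ⟨v, rfl⟩ (w | w) e
  · exact ⟨w, rfl⟩
  · exact Fin.elim0 e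

theorem graphC_mem_partW : ∀ v ∈ partW V W, ∀ w, graphC A B v w → w ∈ partW V W := by
  rintro _ ⟨v, rfl⟩ (w | w) e
  · exact Fin.elim0 e
  · exact ⟨w, rfl⟩

theorem graphD_mem_partW : ∀ v ∈ partV V W, ∀ w, graphD R S v w → w ∈ partW V W := by
  rintro _ ⟨v, rfl⟩ (w | w) e
  · exact Fin.elim0 e
  · exact ⟨w, rfl⟩

theorem exists_graphC_path_from (hA : A.Essential) (hB : B.Essential) (n : ℕ) (v : V ⊕ W) :
    ∃ w, Nonempty (GPath (graphC A B) n v w) := by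
  induction n generalizing v with
  | zero => exact ⟨v, ⟨GPath.nil v⟩⟩
  | succ n ih =>
    obtain ⟨w, ⟨e⟩⟩ := noSinks_graphC hA hB v
    obtain ⟨z, ⟨p⟩⟩ := ih w
    exact ⟨z, ⟨GPath.cons e p⟩⟩

theorem noSources_graphC (hA : A.Essential) (hB : B.Essential) (w : V ⊕ W) :
    ∃ v, Nonempty (graphC A B v w) := by
  rcases w with w | w
  · obtain ⟨v, hv⟩ := hA.2 w
    exact ⟨Sum.inl v, ⟨⟨0, Nat.pos_of_ne_zero hv⟩⟩⟩
  · obtain ⟨v, hv⟩ := hB.2 w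
    exact ⟨Sum.inr v, ⟨⟨0, Nat.pos_of_ne_zero hv⟩⟩⟩

theorem GPath.exists_snoc {Ω : Type u} {E : ArrowGraph.{u, x} Ω} {n : ℕ} {v w z : Ω}
    (p : GPath E n v w) (e : E w z) : Nonempty (GPath E (n + 1) v z) := by
  induction p with
  | nil => exact ⟨GPath.cons e (GPath.nil z)⟩
  | cons f p ih =>
    obtain ⟨q⟩ := ih e
    exact ⟨GPath.cons f q⟩

theorem exists_graphC_path_to (hA : A.Essential) (hB : B.Essential) (n : ℕ) (w : V ⊕ W) :
    ∃ v, Nonempty (GPath (graphC A B) n v w) := by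
  induction n generalizing w with
  | zero => exact ⟨w, ⟨GPath.nil w⟩⟩
  | succ n ih =>
    obtain ⟨z, ⟨e⟩⟩ := noSources_graphC hA hB w
    obtain ⟨v, ⟨p⟩⟩ := ih z
    exact ⟨v, p.exists_snoc e⟩

theorem noSinks_graphD (hA : A.Essential) (hB : B.Essential) {m : ℕ}
    (ψ : PathIso (GPath (graphD R S) 2) (GPath (graphC A B) m)) (v : V ⊕ W) :
    Nonempty (Σ w, graphD R S v w) := by
  obtain ⟨w, ⟨p⟩⟩ := exists_graphC_path_from hA hB m v
  exact ⟨((ψ v w).symm p).head⟩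

/-- A path of length m in C ending at w exists because columns are nonzero. Its preimage under `ψ`
ends with an edge of D into w, and edges of D into W start in V. -/
theorem noSources_graphD (hA : A.Essential) (hB : B.Essential) {m : ℕ}
    (ψ : PathIso (GPath (graphD R S) 2) (GPath (graphC A B) m)) :
    ∀ w ∈ partW V W, ∃ v ∈ partV V W, Nonempty (graphD R S v w) := by
  rintro _ ⟨w, rfl⟩
  obtain ⟨v, ⟨p⟩⟩ := exists_graphC_path_to hA hB m (Sum.inr w)
  obtain ⟨z, ⟨e⟩⟩ : ∃ z, Nonempty (graphD R S z (Sum.inr w)) := by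
    cases (ψ v _).symm p with
    | cons e p => cases p with
      | cons e' p => cases p; exact ⟨_, ⟨e'⟩⟩
  rcases z with z | z
  · exact ⟨_, ⟨z, rfl⟩, ⟨e⟩⟩
  · exact Fin.elim0 e

end BlockGraphs

/-! ### Strong Morita shift equivalence -/

/-- A C*-algebra embeds into the C*-algebra of constant sequences, which lives in any larger
universe. -/
def constHom (𝔄 : Type u) [NonUnitalCStarAlgebra 𝔄] :
    𝔄 →⋆ₙₐ[ℂ] lp (fun _ : PUnit.{v + 1} => 𝔄) ∞ where
  toFun a := ⟨fun _ => a, memℓp_infty ⟨‖a‖, by rintro _ ⟨_, rfl⟩; exact le_rfl⟩⟩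
  map_smul' _ _ := rfl
  map_zero' := rfl
  map_add' _ _ := rfl
  map_mul' _ _ := rfl
  map_star' _ := rfl

theorem constHom_injective (𝔄 : Type u) [NonUnitalCStarAlgebra 𝔄] :
    Function.Injective (constHom.{u, v} 𝔄) := fun _ _ h =>
  congrFun (congrArg Subtype.val h) PUnit.unit

/-! ### From a common representation to the equivalence -/

section Comparison

open GraphCStar CStarCorrespondence

variable {V W : Type u} {A : Matrix V V ℕ} {B : Matrix W W ℕ} {R : Matrix V W ℕ} {S : Matrix W V ℕ}
  {𝔅 : Type (u + 1)} [NonUnitalCStarAlgebra 𝔅] {ρC : GraphCStar (graphC A B) →⋆ₙₐ[ℂ] 𝔅}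
  {ρD : GraphCStar (graphD R S) →⋆ₙₐ[ℂ] 𝔅}

/-- The two cores embed in `𝔅` with equal images: `ψ` gives one inclusion and its inverse the other.
Besides being induced by `ψ`, the isomorphism intertwines the embeddings, which places the changed
coefficients correctly inside `𝔅`. -/
theorem exists_core_equiv {Ω : Type u} {E F : ArrowGraph.{u, 0} Ω} {𝔅 : Type v}
    [NonUnitalCStarAlgebra 𝔅] {ρE : GraphCStar E →⋆ₙₐ[ℂ] 𝔅} {ρF : GraphCStar F →⋆ₙₐ[ℂ] 𝔅}
    (hE : RowFinite E) (hF : RowFinite F) (hsE : ∀ v, Nonempty (Σ w, E v w))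
    (hsF : ∀ v, Nonempty (Σ w, F v w)) (hP : ∀ v, ρE (P E v) = ρF (P F v))
    (h0 : ∀ v, ρF (P F v) ≠ 0) {l m : ℕ} (hl : l ≠ 0) (hm : m ≠ 0)
    (ψ : PathIso (GPath E l) (GPath F m))
    (hψ : ∀ v w (p : GPath E l v w), ρE (pathOp (P E) (GraphCStar.S E) p) =
      ρF (pathOp (P F) (GraphCStar.S F) (ψ v w p))) (K : Set Ω) :
    ∃ Ψ : core E hE K ≃⋆ₐ[ℂ] core F hF K, InducedBy hE hF ψ Ψ ∧
      ∀ a, restrictCore hF K ρF (Ψ a) = restrictCore hE K ρE a := by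
  have h0' : ∀ v, ρE (P E v) ≠ 0 := fun v => hP v ▸ h0 v
  have hψ' : ∀ v w (p : GPath F m v w), ρF (pathOp (P F) (GraphCStar.S F) p) =
      ρE (pathOp (P E) (GraphCStar.S E) ((ψ v w).symm p)) := fun v w p => by
    rw [hψ, Equiv.apply_symm_apply]
  have hinjF := restrictCore_injective hF hsF h0 (K := K)
  obtain ⟨Ψ, hΨ⟩ := exists_starAlgEquiv_of_range_eq (restrictCore hE K ρE) (restrictCore hF K ρF)
    (restrictCore_injective hE hsE h0') hinjF
    (fun a => by
      obtain ⟨b, hb, hab⟩ := map_core_subset hE hF hsE hsF hP h0 hl hψ a.2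
      exact ⟨⟨b, hb⟩, hab⟩)
    (fun b => by
      obtain ⟨a, ha, hab⟩ := map_core_subset hF hE hsF hsE (fun v => (hP v).symm) h0' hm hψ' b.2
      exact ⟨⟨a, ha⟩, hab⟩)
  refine ⟨Ψ, fun k v v' w hv hv' μ μ' => hinjF ?_, hΨ⟩
  rw [hΨ]
  change ρE (blockOp _ μ * star (blockOp _ μ')) = ρF (blockOp _ μ * star (blockOp _ μ'))
  rw [map_mul, map_mul, map_star, map_star, map_blockOp_eq hP hψ, map_blockOp_eq hP hψ]

theorem strongMoritaShiftEquivalentVia_of_homs (hA : A.Essential) (hB : B.Essential)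
    (hA' : A.FinitelySummingRows) (hB' : B.FinitelySummingRows) {m : ℕ} (hm : m ≠ 0)
    (φ : PathIso (GProd (graphC A B) (graphD R S)) (GProd (graphD R S) (graphC A B)))
    (ψ : PathIso (GPath (graphD R S) 2) (GPath (graphC A B) m))
    (hP : ∀ v, ρD (P _ v) = ρC (P _ v)) (h0 : ∀ v, ρC (P _ v) ≠ 0)
    (hψ : ∀ v w (p : GPath (graphD R S) 2 v w), ρD (pathOp (P _) (GraphCStar.S _) p) =
      ρC (pathOp (P _) (GraphCStar.S _) (ψ v w p)))
    (hφ : ∀ v w (cd : GProd (graphC A B) (graphD R S) v w),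
      ρC (GraphCStar.S _ cd.2.1) * ρD (GraphCStar.S _ cd.2.2) =
        ρD (GraphCStar.S _ (φ v w cd).2.1) * ρC (GraphCStar.S _ (φ v w cd).2.2)) :
    StrongMoritaShiftEquivalentVia A B hA hB hA' hB' m R S ψ := by
  have hC : RowFinite (graphC A B) := rowFinite_graphC hA' hB'
  have hD : RowFinite (graphD R S) := rowFinite_of_pathIso hC (noSinks_graphC hA hB) ψ
  have hsC : ∀ v, Nonempty (Σ w, graphC A B v w) := fun v => by
    obtain ⟨w, ⟨e⟩⟩ := noSinks_graphC hA hB v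
    exact ⟨⟨w, e⟩⟩
  have hsD := noSinks_graphD hA hB ψ
  have h0' : ∀ v, ρD (P _ v) ≠ 0 := fun v => hP v ▸ h0 v
  obtain ⟨ΨA, hΨA, hΨA'⟩ := exists_core_equiv hD hC hsD hsC hP h0 two_ne_zero hm ψ hψ (partV V W)
  obtain ⟨ΨB, hΨB, hΨB'⟩ := exists_core_equiv hD hC hsD hsC hP h0 two_ne_zero hm ψ hψ (partW V W)
  have hDC : ∀ (K : Set (V ⊕ W)), ∀ a ∈ spectral (graphD R S) 0 K K,
      ∃ b ∈ spectral (graphC A B) 0 K K, ρC b = ρD a := fun K a ha =>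
    map_core_subset hD hC hsD hsC hP h0 two_ne_zero hψ ha
  -- Here the paths of C are cut into blocks of length m, which requires m ≠ 0.
  have hCD : ∀ (K : Set (V ⊕ W)), ∀ a ∈ spectral (graphC A B) 0 K K,
      ∃ b ∈ spectral (graphD R S) 0 K K, ρD b = ρC a := fun K a ha =>
    map_core_subset hC hD hsC hsD (fun v => (hP v).symm) h0' hm
      (θ := fun v w p => (ψ v w).symm p)
      (fun v w p => by rw [hψ, Equiv.apply_symm_apply]) ha
  refine ⟨ΨA, ΨB, hΨA, hΨB, (dilation_isImprimitivity hD hsD graphD_mem_partW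
    (noSources_graphD hA hB ψ)).changeCoeff ΨA ΨB, ?_⟩
  have hRep := (dilation_isRepresentation hD hsD h0' (partV V W) (partW V W)).changeCoeff
    (restrictCore_injective hC hsC h0) (restrictCore_injective hC hsC h0) hΨA' hΨB'
  refine exists_unitarilyIsomorphic_of_productSpace_eq
    (dilation_isRepresentation hC hsC h0 _ _) (dilation_isRepresentation hC hsC h0 _ _) hRep ?_
  -- The products X(A)_∞ X(R)_∞ are rewritten by `φ`, and the products X(R)_∞ X(B)_∞ by reading `φ`
  -- backwards, which uses its surjectivity.
  apply le_antisymm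
  · refine Submodule.topologicalClosure_minimal _ (Submodule.span_le.2 ?_)
      (Submodule.isClosed_topologicalClosure _)
    rintro _ ⟨x, y, rfl⟩
    refine map_mul_map_mem hC hD (fun v => (hP v).symm) graphC_mem_partV graphD_mem_partW
      graphD_mem_partW (hCD _) (hDC _) (fun v w z e f => ?_)
      (Submodule.isClosed_topologicalClosure _) (fun x hx y hy => ?_) x.2 y.2
    · exact ⟨_, _, _, hφ v z ⟨w, e, f⟩⟩
    · exact Submodule.le_topologicalClosure _ (Submodule.subset_span ⟨⟨x, hx⟩, ⟨y, hy⟩, rfl⟩)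
  · refine Submodule.topologicalClosure_minimal _ (Submodule.span_le.2 ?_)
      (Submodule.isClosed_topologicalClosure _)
    rintro _ ⟨x, y, rfl⟩
    refine map_mul_map_mem hD hC hP graphD_mem_partW graphC_mem_partW
      graphC_mem_partV (hDC _) (hCD _) (fun v w z e f => ?_)
      (Submodule.isClosed_topologicalClosure _) (fun x hx y hy => ?_) x.2 y.2
    · obtain ⟨cd, hcd⟩ := (φ v z).surjective ⟨w, e, f⟩
      have := hφ v z cd
      rw [hcd] at this
      exact ⟨_, _, _, this.symm⟩
    · exact Submodule.le_topologicalClosure _ (Submodule.subset_span ⟨⟨x, hx⟩, ⟨y, hy⟩, rfl⟩)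

end Comparison

theorem map_pathOp {Ω : Type u} {E : ArrowGraph.{u, x} Ω} {𝔄 𝔅 : Type*} [Mul 𝔄] [Mul 𝔅]
    {F : Type*} [FunLike F 𝔄 𝔅] [MulHomClass F 𝔄 𝔅] (f : F) (P : Ω → 𝔄)
    (S : ∀ ⦃v w : Ω⦄, E v w → 𝔄) {n : ℕ} {v w : Ω} (p : GPath E n v w) :
    f (pathOp P S p) = pathOp (fun v => f (P v)) (fun _ _ e => f (S e)) p := by
  induction p with
  | nil => rfl
  | cons e p ih => simp only [pathOp]; rw [map_mul, ih]

end

theorem propositionp {V W : Type u} (A : Matrix V V ℕ) (B : Matrix W W ℕ)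
    (hA : A.Essential) (hB : B.Essential)
    (hA' : A.FinitelySummingRows) (hB' : B.FinitelySummingRows)
    (m : ℕ) (hm : m ≠ 0) (R : Matrix V W ℕ) (S : Matrix W V ℕ)
    (φ : PathIso (GProd (graphC A B) (graphD R S)) (GProd (graphD R S) (graphC A B)))
    (ψ : PathIso (GPath (graphD R S) 2) (GPath (graphC A B) m))
    (h : Representable A B m R S φ ψ) :
    StrongMoritaShiftEquivalentVia A B hA hB hA' hB' m R S ψ := by
  obtain ⟨H, _, _, _, P, SC, TD, hSC, hTD, hP, hψ, hφ⟩ := h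
  -- The operators on `H` live in `Type u`, the graph algebras in `Type (u + 1)`. Product
  -- correspondences need a common universe, so the operators are embedded in a larger one.
  let ι := constHom.{u, u + 1} (H →L[ℂ] H)
  let πC : GraphCStar (graphC A B) →⋆ₙₐ[ℂ] (H →L[ℂ] H) := GraphCStar.rep _ ⟨H, P, SC, hSC⟩
  let πD : GraphCStar (graphD R S) →⋆ₙₐ[ℂ] (H →L[ℂ] H) := GraphCStar.rep _ ⟨H, P, TD, hTD⟩
  refine strongMoritaShiftEquivalentVia_of_homs (ρC := ι.comp πC) (ρD := ι.comp πD) hA hB hA' hB' hm φ ψ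
    (fun v => rfl) (fun v hv => hP v ?_) (fun v w p => ?_) fun v w cd => ?_
  · exact constHom_injective _ (hv.trans (map_zero ι).symm)
  · change ι (πD _) = ι (πC _)
    rw [map_pathOp πD, map_pathOp πC]
    exact congrArg ι (hψ v w p)
  · change ι (SC _) * ι (TD _) = ι (TD _) * ι (SC _)
    rw [← map_mul, ← map_mul, hφ]
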